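/- Theorem 1.7. Let $n\ge 1$ and $m\ge 1$ be integers, $1<p\le q<\infty$, $0<\alpha<n$, $p'=p/(p-1)$, and let $\mu,\nu$ be weights, that is, nonnegative locally integrable functions on $\mathbb{R}^n$. Here $Q$ always denotes a cube with sides parallel to the axes, $|Q|$ its Lebesgue measure, $2Q$ the concentric cube of twice the side length, and $b_Q=\frac1{|Q|}\int_Q b$. Let $$I_\alpha^{b,m}f(x)=\int_{\mathbb{R}^n}(b(x)-b(y))^m\frac{f(y)}{|x-y|^{n-\alpha}}\,dy,\qquad \|b\|_{BMO}=\sup_Q\frac1{|Q|}\int_Q|b-b_Q|\,dx,$$ let $BMO$ be the space of real-valued locally integrable $b$ with $\|b\|_{BMO}<\infty$, let $\|f\|_{L^p(\nu)}=\big(\int_{\mathbb{R}^n}|f|^p\nu\,dx\big)^{1/p}$, and let $\|g\|_{L^{q,\infty}(\mu)}=\sup_{t>0}t\,\mu(\{x:|g(x)|>t\})^{1/q}$, where $\mu(E)=\int_E\mu\,dx$. Suppose that $\mu$ is doubling, that is, for some $D<\infty$ one has $\mu(2Q)\le D\,\mu(Q)$ for all cubes $Q$. Suppose also that there is a constant $C<\infty$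 such that $$\|I_\alpha^{b,m}f\|_{L^{q,\infty}(\mu)}\le C\,\|b\|_{BMO}^m\,\|f\|_{L^p(\nu)}$$ for every $b\in BMO$ and every real-valued Lebesgue measurable $f$ with $\|f\|_{L^p(\nu)}<\infty$ for which the integral defining $I_\alpha^{b,m}f(x)$ converges absolutely for almost every $x$. Then $$\sup_Q|Q|^{\frac{\alpha}{n}+\frac1q-\frac1p}\,\|\mu^{1/q}\|_{q,Q}\,\|\nu^{-1/p}\|_{L^{p'}(\log L)^{mp'},Q}<\infty .$$ Here $\|h\|_{q,Q}=\big(\frac1{|Q|}\int_Q|h|^q\,dx\big)^{1/q}$ and $$\|h\|_{L^{p'}(\log L)^{mp'},Q}=\inf\Big\{\lambda>0:\frac1{|Q|}\int_Q A\Big(\frac{|h(x)|}{\lambda}\Big)dx\le1\Big\},\qquad A(t)=t^{p'}[\log(e+t)]^{mp'},$$ with $\nu^{-1/p}=\infty$ where $\nu=0$, $A(\infty)=\infty$, $\inf\emptyset=\infty$, and $0\cdot\infty=0$. -/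

import Mathlib

open MeasureTheory
open scoped ENNReal NNReal

noncomputable section

namespace FracComm

/-- `ℝⁿ` with its Euclidean norm and Lebesgue measure. -/
abbrev Rn (n : ℕ) : Type := EuclideanSpace ℝ (Fin n)

/-- The closed cube with sides parallel to the axes, centre `c` and side length `l`. -/
def cube {n : ℕ} (c : Rn n) (l : ℝ) : Set (Rn n) :=
  {x | ∀ i, |x i - c i| ≤ l / 2}

/-- A weight: a nonnegative locally integrable function on `ℝⁿ`. -/
structure IsWeight {n : ℕ} (w : Rn n → ℝ) : Prop where
  nonneg : ∀ x, 0 ≤ w x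
  locallyIntegrable : LocallyIntegrable w volume

/-- The measure `w dx`. -/
def weightMeasure {n : ℕ} (w : Rn n → ℝ) : Measure (Rn n) :=
  volume.withDensity fun x => ENNReal.ofReal (w x)

/-- The doubling condition `w(2Q) ≤ D w(Q)` for all cubes `Q`. -/
def IsDoubling {n : ℕ} (w : Rn n → ℝ) : Prop :=
  ∃ D : ℝ≥0, ∀ (c : Rn n) (l : ℝ), 0 < l →
    weightMeasure w (cube c (2 * l)) ≤ D * weightMeasure w (cube c l)

/-- `‖b‖_BMO = sup_Q |Q|⁻¹ ∫_Q |b - b_Q|`, with values in `[0, ∞]`. -/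
def bmoNorm {n : ℕ} (b : Rn n → ℝ) : ℝ≥0∞ :=
  ⨆ (c : Rn n) (l : ℝ) (_ : 0 < l),
    ⨍⁻ x in cube c l, ‖b x - ⨍ y in cube c l, b y ∂volume‖ₑ ∂volume

/-- `b ∈ BMO(ℝⁿ)`. -/
def MemBMO {n : ℕ} (b : Rn n → ℝ) : Prop :=
  LocallyIntegrable b volume ∧ bmoNorm b < ∞

/-- The integrand `y ↦ (b(x) - b(y))^m f(y) / |x - y|^(n - α)`. -/
def commIntegrand {n : ℕ} (α : ℝ) (m : ℕ) (b f : Rn n → ℝ) (x y : Rn n) : ℝ :=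
  (b x - b y) ^ m * (f y / ‖x - y‖ ^ ((n : ℝ) - α))

/-- The iterated commutator `I_α^{b,m} f` of the fractional integral operator. -/
def fracComm {n : ℕ} (α : ℝ) (m : ℕ) (b f : Rn n → ℝ) (x : Rn n) : ℝ :=
  ∫ y, commIntegrand α m b f x y

/-- The integral defining `I_α^{b,m} f(x)` converges absolutely for almost every `x`. -/
def FracCommDefined {n : ℕ} (α : ℝ) (m : ℕ) (b f : Rn n → ℝ) : Prop :=
  ∀ᵐ x, Integrable (commIntegrand α m b f x)

/-- The weak norm `‖g‖_{L^{q,∞}(ρ)} = sup_{t > 0} t ρ({|g| > t})^{1/q}`. -/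
def weakLpNorm {n : ℕ} (q : ℝ) (ρ : Measure (Rn n)) (g : Rn n → ℝ) : ℝ≥0∞ :=
  ⨆ (t : ℝ≥0) (_ : 0 < t), (t : ℝ≥0∞) * ρ {x | (t : ℝ) < |g x|} ^ (1 / q)

/-- The normalized norm `‖h‖_{r,Q} = (|Q|⁻¹ ∫_Q h^r)^{1/r}` of a `[0, ∞]`-valued function. -/
def avgLpNorm {n : ℕ} (r : ℝ) (Q : Set (Rn n)) (h : Rn n → ℝ≥0∞) : ℝ≥0∞ :=
  (⨍⁻ x in Q, h x ^ r ∂volume) ^ (1 / r)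

/-- The Orlicz (Luxemburg) average `‖h‖_{A,Q} = inf {s > 0 : |Q|⁻¹ ∫_Q A(h / s) ≤ 1}` of a
`[0, ∞]`-valued function; it is `∞` if there is no such `s`. -/
def orliczAvg {n : ℕ} (A : ℝ≥0∞ → ℝ≥0∞) (Q : Set (Rn n)) (h : Rn n → ℝ≥0∞) : ℝ≥0∞ :=
  ⨅ (s : ℝ≥0) (_ : 0 < s) (_ : (⨍⁻ x in Q, A (h x / s) ∂volume) ≤ 1), (s : ℝ≥0∞)

/-- The Young function `A(t) = t^r (log (e + t))^s` of the class `L^r (log L)^s`, extended by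
`A(∞) = ∞`. -/
def logBump (r s : ℝ) (t : ℝ≥0∞) : ℝ≥0∞ :=
  if t = ∞ then ∞ else ENNReal.ofReal (t.toReal ^ r * Real.log (Real.exp 1 + t.toReal) ^ s)

end FracComm

end

/-! Fix a cube Q of side l, write r for p', and let S be the translate of Q by 2l along one axis;
doubling gives μ(Q) ≤ D³ μ(S). Truncate ν^{-1/p} to a bounded w, so that w^p ν ≤ 1. If b ≥ 1 on Q
and b = 0 on S, test the hypothesis on f = b^{m(r-1)} w^r 1_Q. On S the commutator is, up to sign,
an integral of a nonnegative function, hence at least a constant times l^{α-n} F with F = ∫_Q b^{mr}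
w^r, while ‖f‖_{L^p(ν)}^p ≤ F. Dividing by F^{1/p} bounds l^{α-n} F^{1/r} μ(S)^{1/q} by a constant
times ‖b‖_BMO^m (`testing_inequality`).

It remains to choose b so that F controls the Orlicz norm. Let a be the mean of w^r over Q, v the
volume of the unit ball, g = v (w^r / a) 1_Q and b = log max(Mg, 1) + 1_Q
(`exists_bmo_dominating_log`). As in Coifman and Rochberg, log max(Mg, 1) lies in BMO with norm
bounded by a dimensional constant (`oscillation_log_maximalFn`), so the bound is uniform in Q and in
the truncation. The mass of g is v|Q|, so Mg ≤ 1 on S, which is at distance at least l from Q; thus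
b = 0 there. Almost everywhere on Q, Mg ≥ g, so b ≥ 1 + log⁺(v w^r / a), which dominates log(e +
w/s) up to a constant when s ≥ a^{1/r}. Hence the Orlicz norm of w is at most a constant times
(F/|Q|)^{1/r} (`setLIntegral_logBump_le`). Fatou's lemma removes the truncation. -/

namespace FracComm

open Metric Set Filter

/-! ### Cubes and balls in Euclidean space -/

section Geometry

variable {n : ℕ}

lemma isClosed_cube (c : Rn n) (l : ℝ) : IsClosed (cube c l) := by
  have : cube c l = ⋂ i, {x : Rn n | |x i - c i| ≤ l / 2} := by
    ext x; simp [cube]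
  rw [this]
  refine isClosed_iInter fun i => isClosed_le ?_ continuous_const
  fun_prop

lemma measurableSet_cube (c : Rn n) (l : ℝ) : MeasurableSet (cube c l) :=
  (isClosed_cube c l).measurableSet

lemma dist_le_of_forall_abs_le {x y : Rn n} {d : ℝ} (hd : 0 ≤ d) (h : ∀ i, |x i - y i| ≤ d) :
    dist x y ≤ n * d := by
  rw [EuclideanSpace.dist_eq]
  refine Real.sqrt_le_iff.2 ⟨by positivity, ?_⟩
  have h1 : ∑ i, dist (x i) (y i) ^ 2 ≤ ∑ _i : Fin n, d ^ 2 :=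
    Finset.sum_le_sum fun i _ => by
      have := h i
      rw [Real.dist_eq]
      gcongr
  refine h1.trans ?_
  rw [Finset.sum_const, Finset.card_univ, Fintype.card_fin, nsmul_eq_mul, mul_pow]
  have : (n : ℝ) ≤ (n : ℝ) ^ 2 := by
    exact_mod_cast Nat.le_self_pow two_ne_zero n
  gcongr

lemma abs_sub_le_dist (x y : Rn n) (i : Fin n) : |x i - y i| ≤ dist x y := by
  rw [dist_eq_norm]
  simpa using PiLp.norm_apply_le (x - y) i

lemma cube_subset_closedBall (c : Rn n) {l : ℝ} (hl : 0 ≤ l) :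
    cube c l ⊆ closedBall c (n * (l / 2)) :=
  fun _ hx => dist_le_of_forall_abs_le (by positivity) hx

lemma volume_cube (c : Rn n) (l : ℝ) :
    volume (cube c l) = ENNReal.ofReal l ^ n := by
  have h := (EuclideanSpace.volume_preserving_symm_measurableEquiv_toLp (Fin n)).measure_preimage
    (measurableSet_Icc (a := fun i => c i - l / 2) (b := fun i => c i + l / 2)).nullMeasurableSet
  have h2 : cube c l = (MeasurableEquiv.toLp 2 (Fin n → ℝ)).symm ⁻¹'
      (Icc (fun i => c i - l / 2) (fun i => c i + l / 2)) := by
    ext x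
    simp only [cube, mem_ofPred_eq, mem_preimage, mem_Icc, Pi.le_def, ← forall_and]
    refine forall_congr' fun i => ?_
    change |x i - c i| ≤ l / 2 ↔ c i - l / 2 ≤ x i ∧ x i ≤ c i + l / 2
    rw [abs_le]
    constructor <;> rintro ⟨h1, h2⟩ <;> constructor <;> linarith
  rw [h2, h, Real.volume_Icc_pi]
  simp [Finset.prod_const]

lemma volume_cube_pos (c : Rn n) {l : ℝ} (hl : 0 < l) : volume (cube c l) ≠ 0 := by
  rw [volume_cube]; simp [hl]

lemma volume_cube_ne_top (c : Rn n) (l : ℝ) : volume (cube c l) ≠ ∞ := by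
  rw [volume_cube]; finiteness

/-- The volume of the unit ball of `ℝⁿ`. -/
noncomputable def unitBallVolume (n : ℕ) : ℝ≥0∞ := volume (ball (0 : Rn n) 1)

lemma unitBallVolume_ne_zero (n : ℕ) : unitBallVolume n ≠ 0 :=
  (measure_ball_pos volume _ one_pos).ne'

lemma unitBallVolume_ne_top (n : ℕ) : unitBallVolume n ≠ ∞ := measure_ball_lt_top.ne

lemma volume_closedBall_eq (x : Rn n) {r : ℝ} (hr : 0 ≤ r) :
    volume (closedBall x r) = ENNReal.ofReal r ^ n * unitBallVolume n := by
  rw [Measure.addHaar_closedBall _ _ hr, finrank_euclideanSpace_fin, ENNReal.ofReal_pow hr,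
    unitBallVolume]

lemma volume_closedBall_ne_zero (x : Rn n) {r : ℝ} (hr : 0 < r) :
    volume (closedBall x r) ≠ 0 := (measure_closedBall_pos volume x hr).ne'

lemma volume_closedBall_ne_top (x : Rn n) (r : ℝ) :
    volume (closedBall x r) ≠ ∞ := measure_closedBall_lt_top.ne

lemma volume_closedBall_mul (x y : Rn n) {r s : ℝ} (hs : 0 ≤ s) (hr : 0 ≤ r) :
    volume (closedBall x (s * r)) = ENNReal.ofReal s ^ n * volume (closedBall y r) := by
  rw [volume_closedBall_eq x (mul_nonneg hs hr), volume_closedBall_eq y hr,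
    ENNReal.ofReal_mul hs, mul_pow, mul_assoc]

end Geometry

/-! ### The dyadic-radius maximal function -/

section Maximal

variable {n : ℕ}

/-- The centred maximal function over closed balls of dyadic radii. -/
noncomputable def maximalFn (g : Rn n → ℝ≥0∞) (x : Rn n) : ℝ≥0∞ :=
  ⨆ k : ℤ, (∫⁻ y in closedBall x ((2 : ℝ) ^ k), g y) / volume (closedBall x ((2 : ℝ) ^ k))

/-- The radii are countable, so it suffices to treat one radius, where the average is a parameter
integral of a jointly measurable function. -/
lemma measurable_maximalFn {g : Rn n → ℝ≥0∞} (hg : Measurable g) : Measurable (maximalFn g) := by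
  refine Measurable.iSup fun k => ?_
  have h2 : (0 : ℝ) ≤ 2 ^ k := by positivity
  simp_rw [volume_closedBall_eq _ h2]
  refine Measurable.div_const ?_ _
  have : ∀ x : Rn n, ∫⁻ y in closedBall x ((2 : ℝ) ^ k), g y =
      ∫⁻ y, {z : Rn n × Rn n | dist z.2 z.1 ≤ 2 ^ k}.indicator (fun z => g z.2) (x, y) := by
    intro x
    rw [← lintegral_indicator measurableSet_closedBall]
    rfl
  simp_rw [this]
  refine Measurable.lintegral_prod_right'
    (f := fun z => {z : Rn n × Rn n | dist z.2 z.1 ≤ 2 ^ k}.indicator (fun z => g z.2) z) ?_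
  refine Measurable.indicator (hg.comp measurable_snd) ?_
  exact measurableSet_le (by fun_prop) measurable_const

lemma lintegral_closedBall_le_maximalFn (g : Rn n → ℝ≥0∞) (x : Rn n) (k : ℤ) :
    ∫⁻ y in closedBall x ((2 : ℝ) ^ k), g y ≤
      volume (closedBall x ((2 : ℝ) ^ k)) * maximalFn g x := by
  have h := le_iSup (fun k : ℤ => (∫⁻ y in closedBall x ((2 : ℝ) ^ k), g y) /
    volume (closedBall x ((2 : ℝ) ^ k))) k
  rw [mul_comm]
  exact (ENNReal.div_le_iff (volume_closedBall_ne_zero x (by positivity))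
    (volume_closedBall_ne_top x _)).1 h

/-- The weak type `(1,1)` bound for the maximal function. -/
lemma volume_maximalFn_gt_le (hn : n ≠ 0) (g : Rn n → ℝ≥0∞) {t : ℝ≥0∞}
    (ht : t ≠ 0) (htop : t ≠ ∞) :
    volume {x | t < maximalFn g x} ≤ 5 ^ n * (∫⁻ y, g y) / t := by
  rcases eq_or_ne (∫⁻ y, g y) ∞ with hI | hI
  · simp [hI, ENNReal.top_div, htop]
  have hex : ∀ x ∈ {x | t < maximalFn g x}, ∃ k : ℤ,
      t * volume (closedBall x ((2 : ℝ) ^ k)) < ∫⁻ y in closedBall x ((2 : ℝ) ^ k), g y := by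
    intro x hx
    obtain ⟨k, hk⟩ := lt_iSup_iff.1 (id hx : t < maximalFn g x)
    exact ⟨k, (ENNReal.lt_div_iff_mul_lt (.inl (volume_closedBall_ne_zero x (by positivity)))
      (.inl (volume_closedBall_ne_top x _))).1 hk⟩
  choose! k hk using hex
  set S := {x | t < maximalFn g x} with hS
  set I := ∫⁻ y, g y
  -- The Vitali covering lemma needs bounded radii: the selected balls satisfy t|B| ≤ ∫ g, and a
  -- radius above 1 is at most its n-th power.
  have hbd : ∀ x ∈ S, (2 : ℝ) ^ k x ≤ max 1 (I / (t * unitBallVolume n)).toReal := by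
    intro x hx
    rcases le_or_gt ((2 : ℝ) ^ k x) 1 with h1 | h1
    · exact le_max_of_le_left h1
    refine le_max_of_le_right ?_
    have h2 := (hk x hx).le.trans (setLIntegral_le_lintegral _ _)
    rw [volume_closedBall_eq x (by positivity)] at h2
    have hv0 := unitBallVolume_ne_zero n
    have hvt := unitBallVolume_ne_top n
    rw [← ENNReal.ofReal_le_iff_le_toReal
      (ENNReal.div_ne_top hI (mul_ne_zero ht hv0))]
    rw [ENNReal.le_div_iff_mul_le (.inl (mul_ne_zero ht hv0)) (.inl (ENNReal.mul_ne_top htop hvt))]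
    refine le_trans ?_ h2
    rw [mul_left_comm]
    gcongr
    exact le_self_pow₀ (by simpa using h1.le) hn
  obtain ⟨u, huS, hdisj, hcov⟩ := Vitali.exists_disjoint_subfamily_covering_enlargement_closedBall
    S (fun x => x) (fun x => (2 : ℝ) ^ k x) _ hbd 5 (by norm_num)
  have hucount : u.Countable := hdisj.countable_of_nonempty_interior fun x _ =>
    ⟨x, ball_subset_interior_closedBall (mem_ball_self (by positivity))⟩
  have hsub : S ⊆ ⋃ x ∈ u, closedBall x (5 * (2 : ℝ) ^ k x) := by
    intro x hx
    obtain ⟨y, hy, hxy⟩ := hcov x hx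
    exact mem_biUnion hy (hxy (mem_closedBall_self (by positivity)))
  rw [ENNReal.le_div_iff_mul_le (.inl ht) (.inl htop)]
  have : Countable u := hucount
  calc volume S * t ≤ (∑' x : u, volume (closedBall (x : Rn n) (5 * (2 : ℝ) ^ k x))) * t := by
        gcongr
        exact (measure_mono hsub).trans (measure_biUnion_le _ hucount _)
    _ = 5 ^ n * ∑' x : u, t * volume (closedBall (x : Rn n) ((2 : ℝ) ^ k x)) := by
        rw [← ENNReal.tsum_mul_right, ← ENNReal.tsum_mul_left]
        refine tsum_congr fun x => ?_
        rw [volume_closedBall_mul (x : Rn n) (x : Rn n) (by norm_num) (by positivity)]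
        simp only [ENNReal.ofReal_ofNat]
        ring
    _ ≤ 5 ^ n * ∑' x : u, ∫⁻ y in closedBall (x : Rn n) ((2 : ℝ) ^ k x), g y := by
        gcongr with x
        exact (hk x (huS x.2)).le
    _ = 5 ^ n * ∫⁻ y in ⋃ x ∈ u, closedBall (x : Rn n) ((2 : ℝ) ^ k x), g y := by
        rw [lintegral_biUnion hucount (fun _ _ => measurableSet_closedBall) hdisj]
    _ ≤ 5 ^ n * I := by
        gcongr
        exact setLIntegral_le_lintegral _ _

/-- The maximal function dominates the function almost everywhere. -/
lemma ae_le_maximalFn {g : Rn n → ℝ≥0∞} (hg : Measurable g) (hI : ∫⁻ y, g y ≠ ∞) :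
    ∀ᵐ x, g x ≤ maximalFn g x := by
  filter_upwards [(Besicovitch.vitaliFamily (volume : Measure (Rn n))).ae_tendsto_lintegral_div'
    hg hI] with x hx
  have h1 := hx.comp (Besicovitch.tendsto_filterAt volume x)
  have h2 : Tendsto (fun j : ℕ => (2 : ℝ) ^ (-(j : ℤ))) atTop (nhdsWithin 0 (Ioi 0)) := by
    refine tendsto_nhdsWithin_iff.2 ⟨?_, .of_forall fun j => by simp⟩
    have := tendsto_pow_atTop_nhds_zero_of_lt_one (r := (1 / 2 : ℝ)) (by norm_num) (by norm_num)
    refine this.congr fun j => ?_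
    simp
  refine le_of_tendsto (h1.comp h2) (.of_forall fun j => ?_)
  exact le_iSup (fun k : ℤ => (∫⁻ y in closedBall x ((2 : ℝ) ^ k), g y) /
    volume (closedBall x ((2 : ℝ) ^ k))) (-(j : ℤ))

lemma maximalFn_le_of_forall_le {g : Rn n → ℝ≥0∞} {N : ℝ≥0∞} (h : ∀ x, g x ≤ N) (x : Rn n) :
    maximalFn g x ≤ N := by
  refine iSup_le fun k => ENNReal.div_le_of_le_mul ?_
  calc ∫⁻ y in closedBall x ((2 : ℝ) ^ k), g y ≤ ∫⁻ _ in closedBall x ((2 : ℝ) ^ k), N :=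
        lintegral_mono fun y => h y
    _ = _ := setLIntegral_const _ _

/-- Away from the support of `g`, the maximal function is controlled by the total mass. -/
lemma maximalFn_le_of_dist {g : Rn n → ℝ≥0∞} {s : Set (Rn n)} (hg : ∀ y ∉ s, g y = 0)
    {x : Rn n} {d : ℝ} (hx : ∀ y ∈ s, d ≤ dist y x) :
    maximalFn g x ≤ (∫⁻ y, g y) / (ENNReal.ofReal d ^ n * unitBallVolume n) := by
  refine iSup_le fun k => ?_
  -- Balls of radius below d miss s; the others have at least the volume of a ball of radius d.
  rcases lt_or_ge ((2 : ℝ) ^ k) d with h | h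
  · have : ∫⁻ y in closedBall x ((2 : ℝ) ^ k), g y = 0 := by
      refine setLIntegral_eq_zero measurableSet_closedBall fun y hy => hg y fun hys => ?_
      exact absurd (hx y hys) (not_le.2 (lt_of_le_of_lt hy h))
    simp [this]
  · rw [volume_closedBall_eq x (by positivity)]
    gcongr
    exact Measure.restrict_le_self

end Maximal

/-! ### BMO and the logarithm of a maximal function -/

section BMO

variable {n : ℕ}

lemma lintegral_enorm_sub_integral_le {Ω : Type*} [MeasurableSpace Ω] {P : Measure Ω}
    [IsProbabilityMeasure P] {b : Ω → ℝ} (hb : Integrable b P) (a : ℝ) :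
    ∫⁻ x, ‖b x - ∫ y, b y ∂P‖ₑ ∂P ≤ 2 * ∫⁻ x, ‖b x - a‖ₑ ∂P := by
  have h1 : ‖a - ∫ y, b y ∂P‖ₑ ≤ ∫⁻ x, ‖b x - a‖ₑ ∂P := by
    have : a - ∫ y, b y ∂P = -∫ y, (b y - a) ∂P := by
      rw [integral_sub hb (integrable_const a)]
      simp
    rw [this, enorm_neg]
    exact enorm_integral_le_lintegral_enorm _
  calc ∫⁻ x, ‖b x - ∫ y, b y ∂P‖ₑ ∂P
      ≤ ∫⁻ x, (‖b x - a‖ₑ + ‖a - ∫ y, b y ∂P‖ₑ) ∂P := by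
        refine lintegral_mono fun x => ?_
        rw [← sub_add_sub_cancel (b x) a]
        exact enorm_add_le _ _
    _ = ∫⁻ x, ‖b x - a‖ₑ ∂P + ‖a - ∫ y, b y ∂P‖ₑ := by
        rw [lintegral_add_right _ measurable_const]
        simp
    _ ≤ _ := by
        rw [two_mul]
        gcongr

/-- By the triangle inequality, replacing an arbitrary constant by the mean costs at most a factor
2. -/
lemma bmoNorm_le_of_oscillation {b : Rn n → ℝ} (hb : LocallyIntegrable b volume) {K : ℝ≥0∞}
    (h : ∀ (c : Rn n) (l : ℝ), 0 < l →
      ∃ a : ℝ, ∫⁻ x in cube c l, ‖b x - a‖ₑ ≤ K * volume (cube c l)) :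
    bmoNorm b ≤ 2 * K := by
  refine iSup_le fun c => iSup_le fun l => iSup_le fun hl => ?_
  obtain ⟨a, ha⟩ := h c l hl
  have h0 := volume_cube_pos c hl
  have ht := volume_cube_ne_top c l
  have hbi : IntegrableOn b (cube c l) volume := by
    refine (hb.integrableOn_isCompact (isCompact_closedBall c (n * (l / 2)))).mono_set ?_
    exact cube_subset_closedBall c hl.le
  rw [laverage_eq', average_eq']
  have : IsFiniteMeasure (volume.restrict (cube c l)) := ⟨by simpa using ht.lt_top⟩
  have : NeZero (volume.restrict (cube c l)) := ⟨by simpa using h0⟩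
  refine (lintegral_enorm_sub_integral_le ?_ a).trans ?_
  · exact hbi.smul_measure (by simpa using h0)
  · gcongr
    rw [lintegral_smul_measure, smul_eq_mul, Measure.restrict_apply_univ, mul_comm,
      ← div_eq_mul_inv]
    exact ENNReal.div_le_of_le_mul ha

/-- The natural logarithm is at most the binary one for u ≥ 1, and the ceiling of the latter counts
the k with 2^k < u. This turns the integral of a logarithm into a sum of measures of level sets. -/
lemma ofReal_log_le_tsum {u : ℝ} (hu : 1 ≤ u) :
    ENNReal.ofReal (Real.log u) ≤ ∑' k : ℕ, if (2 : ℝ) ^ k < u then (1 : ℝ≥0∞) else 0 := by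
  set N := ⌈Real.logb 2 u⌉₊ with hN
  have hlogb : 0 ≤ Real.logb 2 u := Real.logb_nonneg (by norm_num) hu
  have h1 : Real.log u ≤ N := by
    refine le_trans ?_ (Nat.le_ceil _)
    have h2 : Real.log u = Real.logb 2 u * Real.log 2 := by
      rw [Real.logb, div_mul_cancel₀]
      exact (Real.log_pos (by norm_num)).ne'
    rw [h2]
    exact mul_le_of_le_one_right hlogb (Real.log_two_lt_d9.le.trans (by norm_num))
  calc ENNReal.ofReal (Real.log u) ≤ ENNReal.ofReal N := ENNReal.ofReal_le_ofReal h1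
    _ = ∑ k ∈ Finset.range N, (1 : ℝ≥0∞) := by simp
    _ = ∑ k ∈ Finset.range N, if (2 : ℝ) ^ k < u then (1 : ℝ≥0∞) else 0 := by
        refine Finset.sum_congr rfl fun k hk => (if_pos ?_).symm
        have h3 : (k : ℝ) < Real.logb 2 u := Nat.lt_ceil.1 (Finset.mem_range.1 hk)
        rw [Real.lt_logb_iff_rpow_lt (by norm_num) (by linarith)] at h3
        simpa using h3
    _ ≤ _ := ENNReal.sum_le_tsum _

/-- The constant in the bound for the oscillation of the logarithm of a maximal function. -/
noncomputable def oscConst (n : ℕ) : ℝ≥0∞ :=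
  ENNReal.ofReal (n * Real.log 2) + 2 * 5 ^ n * ((8 * n) ^ n * unitBallVolume n)

lemma oscConst_ne_top (n : ℕ) : oscConst n ≠ ∞ := by
  have := unitBallVolume_ne_top n
  unfold oscConst
  finiteness

/-- Localisation of the maximal function to a cube. -/
lemma maximalFn_le_max {g : Rn n → ℝ≥0∞} {c : Rn n} {l : ℝ} (hl : 0 < l) {j : ℤ}
    (hj : n * l ≤ (2 : ℝ) ^ j) {x y : Rn n} (hx : x ∈ cube c l) (hy : y ∈ cube c l) :
    maximalFn g x ≤ max (maximalFn ((closedBall c (2 * 2 ^ j)).indicator g) x)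
      (2 ^ n * maximalFn g y) := by
  have hxc : dist x c ≤ n * (l / 2) := cube_subset_closedBall c hl.le hx
  have hyc : dist y c ≤ n * (l / 2) := cube_subset_closedBall c hl.le hy
  refine iSup_le fun k => ?_
  -- Small balls lie inside the localising ball. A larger ball about x lies in the ball of twice the
  -- radius about y, at the cost of the volume ratio 2^n.
  rcases le_or_gt k j with hk | hk
  · refine le_max_of_le_left ?_
    have hkj : (2 : ℝ) ^ k ≤ 2 ^ j := zpow_le_zpow_right₀ (by norm_num) hk
    refine le_trans (le_of_eq ?_) (le_iSup (fun k : ℤ =>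
      (∫⁻ y in closedBall x ((2 : ℝ) ^ k), (closedBall c (2 * 2 ^ j)).indicator g y) /
        volume (closedBall x ((2 : ℝ) ^ k))) k)
    congr 1
    refine setLIntegral_congr_fun measurableSet_closedBall fun z hz => ?_
    rw [indicator_of_mem]
    refine closedBall_subset_closedBall' ?_ hz
    nlinarith
  · refine le_max_of_le_right (ENNReal.div_le_of_le_mul ?_)
    have hkj : (2 : ℝ) ^ j ≤ 2 ^ k := zpow_le_zpow_right₀ (by norm_num) hk.le
    have hxy : dist x y ≤ 2 ^ k := by
      have := dist_triangle_right x y c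
      nlinarith
    calc ∫⁻ z in closedBall x ((2 : ℝ) ^ k), g z
        ≤ ∫⁻ z in closedBall y ((2 : ℝ) ^ (k + 1)), g z := by
          refine lintegral_mono_set (closedBall_subset_closedBall' ?_)
          rw [zpow_add_one₀ (by norm_num)]
          linarith
      _ ≤ volume (closedBall y ((2 : ℝ) ^ (k + 1))) * maximalFn g y :=
          lintegral_closedBall_le_maximalFn g y (k + 1)
      _ = 2 ^ n * maximalFn g y * volume (closedBall x ((2 : ℝ) ^ k)) := by
          rw [zpow_add_one₀ (by norm_num), mul_comm ((2 : ℝ) ^ k),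
            volume_closedBall_mul y x (by norm_num) (by positivity)]
          simp only [ENNReal.ofReal_ofNat]
          ring

/-- Compare with log B, where B = max(inf Mg, 1) over the cube. Large radii contribute at most 2^n
B, hence n log 2 after taking logarithms; the local part g₁ has mass at most a constant times B
times the volume of the cube, so the weak (1,1) bound at the levels 2^k B sums geometrically. -/
lemma oscillation_log_maximalFn (hn : n ≠ 0) {g : Rn n → ℝ≥0∞} (hg : Measurable g)
    (hfin : ∀ x, maximalFn g x ≠ ∞) (c : Rn n) {l : ℝ} (hl : 0 < l) :
    ∃ a : ℝ, ∫⁻ x in cube c l, ‖Real.log (max (maximalFn g x) 1).toReal - a‖ₑ ≤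
      oscConst n * volume (cube c l) := by
  obtain ⟨j, hj⟩ : ∃ j : ℤ, n * l ≤ (2 : ℝ) ^ j ∧ (2 : ℝ) ^ j ≤ 2 * (n * l) := by
    obtain ⟨j, hj⟩ := exists_mem_Ico_zpow (x := 2 * (n * l)) (y := (2 : ℝ))
      (by positivity) (by norm_num)
    refine ⟨j, ?_, hj.1⟩
    have := hj.2
    rw [zpow_add_one₀ (by norm_num)] at this
    linarith
  obtain ⟨hj1, hj2⟩ := hj
  set g₁ := (closedBall c (2 * 2 ^ j)).indicator g with hg₁
  set A : ℝ≥0∞ := ⨅ y ∈ cube c l, maximalFn g y with hA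
  have hcc : c ∈ cube c l := fun i => by simpa using (half_pos hl).le
  have hAle : ∀ x ∈ cube c l, A ≤ maximalFn g x := fun x hx => biInf_le _ hx
  have hAtop : A ≠ ∞ := ne_top_of_le_ne_top (hfin c) (hAle c hcc)
  set B := max A 1 with hB
  have hBtop : B ≠ ∞ := by simp [hB, hAtop]
  have hB0 : B ≠ 0 := (zero_lt_one.trans_le (le_max_right A 1)).ne'
  have hB1 : 1 ≤ B.toReal := by
    rw [← ENNReal.toReal_one]
    exact ENNReal.toReal_mono hBtop (le_max_right _ _)
  -- For each y in the cube, the ball of radius 2^{j+2} ≤ 8nl about y contains the localising ball;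
  -- take the infimum over y.
  have hmass : ∫⁻ y, g₁ y ≤ (8 * n) ^ n * unitBallVolume n * volume (cube c l) * B := by
    rw [lintegral_indicator measurableSet_closedBall]
    have hV : ∀ y : Rn n, volume (closedBall y ((2 : ℝ) ^ (j + 2))) ≤
        (8 * n) ^ n * unitBallVolume n * volume (cube c l) := by
      intro y
      rw [volume_closedBall_eq y (by positivity), volume_cube, mul_right_comm, ← mul_pow]
      gcongr
      have : (8 * n : ℝ≥0∞) * ENNReal.ofReal l = ENNReal.ofReal (8 * n * l) := by
        rw [ENNReal.ofReal_mul (by positivity), ENNReal.ofReal_mul (by positivity)]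
        simp
      rw [this]
      refine ENNReal.ofReal_le_ofReal ?_
      rw [zpow_add₀ (by norm_num)]
      norm_num
      linarith
    have hv0 : (8 * n : ℝ≥0∞) ^ n * unitBallVolume n * volume (cube c l) ≠ 0 := by
      refine mul_ne_zero (mul_ne_zero (pow_ne_zero _ ?_) (unitBallVolume_ne_zero n))
        (volume_cube_pos c hl)
      simp [hn]
    have hvt : (8 * n : ℝ≥0∞) ^ n * unitBallVolume n * volume (cube c l) ≠ ∞ := by
      have := unitBallVolume_ne_top n
      have := volume_cube_ne_top c l
      finiteness
    rw [mul_comm _ B, ← ENNReal.div_le_iff hv0 hvt]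
    refine le_trans (le_iInf₂ fun y hy => ?_) (le_max_left A 1)
    refine ENNReal.div_le_of_le_mul ?_
    calc ∫⁻ z in closedBall c (2 * 2 ^ j), g z
        ≤ ∫⁻ z in closedBall y ((2 : ℝ) ^ (j + 2)), g z := by
          refine lintegral_mono_set (closedBall_subset_closedBall' ?_)
          have hyc : dist y c ≤ n * (l / 2) := cube_subset_closedBall c hl.le hy
          rw [dist_comm, zpow_add₀ (by norm_num)]
          norm_num
          nlinarith
      _ ≤ volume (closedBall y ((2 : ℝ) ^ (j + 2))) * maximalFn g y :=
          lintegral_closedBall_le_maximalFn g y (j + 2)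
      _ ≤ _ := by
          rw [mul_comm]
          gcongr
          exact hV y
  have hpt : ∀ x ∈ cube c l, ‖Real.log (max (maximalFn g x) 1).toReal - Real.log B.toReal‖ₑ ≤
      ENNReal.ofReal (n * Real.log 2) +
        ∑' k : ℕ, {x | 2 ^ k * B < maximalFn g₁ x}.indicator (fun _ => (1 : ℝ≥0∞)) x := by
    intro x hx
    set T := max (maximalFn g x) 1 with hT
    have hTtop : T ≠ ∞ := by simp [hT, hfin x]
    have hBT : B ≤ T := max_le_max_right 1 (hAle x hx)
    have hBT' : B.toReal ≤ T.toReal := ENNReal.toReal_mono hTtop hBT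
    have hu : 1 ≤ T.toReal / B.toReal := by rwa [one_le_div (by linarith)]
    have hTle : T ≤ max (maximalFn g₁ x) (2 ^ n * B) := by
      refine max_le ?_ ?_
      · have h2 : ∀ y ∈ cube c l, maximalFn g₁ x < maximalFn g x →
            maximalFn g x ≤ 2 ^ n * maximalFn g y := by
          intro y hy hlt
          exact (le_max_iff.1 (maximalFn_le_max hl hj1 hx hy)).resolve_left (not_le.2 hlt)
        rcases le_or_gt (maximalFn g x) (maximalFn g₁ x) with h | h
        · exact le_max_of_le_left h
        · refine le_max_of_le_right ?_
          rw [mul_comm, ← ENNReal.div_le_iff (by simp) (by finiteness)]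
          refine le_trans (le_iInf₂ fun y hy => ?_) (le_max_left A 1)
          refine ENNReal.div_le_of_le_mul ?_
          rw [mul_comm]
          exact h2 y hy h
      · refine le_max_of_le_right ?_
        calc (1 : ℝ≥0∞) = 1 * 1 := by simp
          _ ≤ 2 ^ n * B := mul_le_mul' (one_le_pow₀ (by norm_num)) (le_max_right _ _)
    rw [← Real.log_div (by linarith) (by linarith), Real.enorm_of_nonneg (Real.log_nonneg hu)]
    -- Either T/B ≤ 2^n, or T ≤ Mg₁ and every level 2^k < T/B is counted by a level set of Mg₁.
    rcases le_or_gt T (2 ^ n * B) with h | h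
    · refine le_add_right (ENNReal.ofReal_le_ofReal ?_)
      rw [← Real.log_pow]
      refine Real.log_le_log (by linarith) ?_
      rw [div_le_iff₀ (by linarith)]
      have := ENNReal.toReal_mono (by finiteness) h
      simpa using this
    · refine le_add_left ((ofReal_log_le_tsum hu).trans (ENNReal.tsum_le_tsum fun k => ?_))
      split_ifs with hk
      · rw [indicator_of_mem]
        have hT1 : T ≤ maximalFn g₁ x := (le_max_iff.1 hTle).resolve_right (not_le.2 h)
        refine lt_of_lt_of_le ?_ hT1
        rw [lt_div_iff₀ (by linarith)] at hk
        rw [← ENNReal.toReal_lt_toReal (by finiteness) hTtop]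
        simpa using hk
      · exact zero_le
  have hmeas : Measurable (maximalFn g₁) :=
    measurable_maximalFn (hg.indicator measurableSet_closedBall)
  have hms : ∀ k : ℕ, MeasurableSet {x | 2 ^ k * B < maximalFn g₁ x} := fun k =>
    measurableSet_lt measurable_const hmeas
  refine ⟨Real.log B.toReal, (setLIntegral_mono' (measurableSet_cube c l) hpt).trans ?_⟩
  rw [lintegral_add_left measurable_const, setLIntegral_const, oscConst, add_mul]
  gcongr
  calc ∫⁻ x in cube c l, ∑' k : ℕ,
        {x | 2 ^ k * B < maximalFn g₁ x}.indicator (fun _ => (1 : ℝ≥0∞)) x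
      ≤ ∫⁻ x, ∑' k : ℕ, {x | 2 ^ k * B < maximalFn g₁ x}.indicator (fun _ => (1 : ℝ≥0∞)) x :=
        setLIntegral_le_lintegral _ _
    _ = ∑' k : ℕ, volume {x | 2 ^ k * B < maximalFn g₁ x} := by
        rw [lintegral_tsum fun k => (measurable_const.indicator (hms k)).aemeasurable]
        refine tsum_congr fun k => ?_
        rw [lintegral_indicator_const (hms k), one_mul]
    _ ≤ ∑' k : ℕ, 5 ^ n * (∫⁻ y, g₁ y) / (2 ^ k * B) :=
        ENNReal.tsum_le_tsum fun k => volume_maximalFn_gt_le hn g₁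
          (mul_ne_zero (by simp) hB0) (by finiteness)
    _ = 2 * (5 ^ n * (∫⁻ y, g₁ y) / B) := by
        have : ∀ k : ℕ, 5 ^ n * (∫⁻ y, g₁ y) / (2 ^ k * B) =
            2⁻¹ ^ k * (5 ^ n * (∫⁻ y, g₁ y) / B) := by
          intro k
          rw [ENNReal.div_eq_inv_mul, ENNReal.div_eq_inv_mul,
            ENNReal.mul_inv (.inr hBtop) (.inr hB0), ENNReal.inv_pow, mul_assoc]
        simp_rw [this]
        rw [ENNReal.tsum_mul_right, ENNReal.tsum_geometric]
        simp
    _ ≤ 2 * (5 ^ n * ((8 * n) ^ n * unitBallVolume n * volume (cube c l))) := by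
        gcongr
        refine ENNReal.div_le_of_le_mul ?_
        rw [mul_assoc]
        gcongr
    _ = _ := by ring

end BMO

/-! ### Testing the weak type inequality -/

section Testing

variable {n : ℕ}

/-- In polar coordinates the integrand becomes r^{α-1} on (0, R), integrable since α > 0. -/
lemma integrable_indicator_norm_rpow (hn : n ≠ 0) {α : ℝ} (hα : 0 < α) (R : ℝ) :
    Integrable (fun z : Rn n => (Iio R).indicator (fun r : ℝ => r ^ (α - n)) ‖z‖) := by
  have : Nonempty (Fin n) := ⟨⟨0, Nat.pos_of_ne_zero hn⟩⟩
  rw [integrable_fun_norm_addHaar, finrank_euclideanSpace_fin]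
  rcases le_or_gt R 0 with hR | hR
  · refine integrableOn_zero.congr_fun (fun y hy => ?_) measurableSet_Ioi
    rw [indicator_of_notMem]
    · simp
    · exact not_lt.2 (hR.trans (le_of_lt hy))
  have h1 : IntegrableOn (fun y : ℝ => y ^ (α - 1)) (Ioo 0 R) :=
    (intervalIntegral.integrableOn_Ioo_rpow_iff hR).2 (by linarith)
  have h2 : IntegrableOn ((Ioo 0 R).indicator fun y : ℝ => y ^ (α - 1)) (Ioi 0) :=
    (h1.integrable_indicator measurableSet_Ioo).integrableOn
  refine h2.congr_fun (fun y hy => ?_) measurableSet_Ioi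
  have hy0 : 0 < y := hy
  by_cases hyR : y < R
  · rw [indicator_of_mem (show y ∈ Ioo 0 R from ⟨hy0, hyR⟩),
      indicator_of_mem (show y ∈ Iio R from hyR), smul_eq_mul, ← Real.rpow_natCast,
      ← Real.rpow_add hy0, Nat.cast_sub (Nat.one_le_iff_ne_zero.2 hn)]
    congr 1
    push_cast
    ring
  · rw [indicator_of_notMem (show y ∉ Ioo 0 R from fun h => hyR h.2),
      indicator_of_notMem (show y ∉ Iio R from hyR), smul_zero]

/-- A bounded function supported in a cube has an absolutely convergent fractional integral at
every point. -/
lemma integrable_div_norm_rpow (hn : n ≠ 0) {α : ℝ} (hα : 0 < α) {c : Rn n} {l : ℝ} (hl : 0 ≤ l)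
    {F : Rn n → ℝ} (hF : AEStronglyMeasurable F volume) {B : ℝ} (hB : ∀ y, |F y| ≤ B)
    (hsupp : ∀ y ∉ cube c l, F y = 0) (x : Rn n) :
    Integrable fun y => F y / ‖x - y‖ ^ ((n : ℝ) - α) := by
  set R : ℝ := dist x c + n * (l / 2) + 1
  have h1 := ((integrable_indicator_norm_rpow hn hα R).comp_sub_left x).const_mul B
  refine h1.mono ?_ (.of_forall fun y => ?_)
  · refine AEMeasurable.aestronglyMeasurable ?_
    refine hF.aemeasurable.div (Measurable.aemeasurable ?_)
    fun_prop
  · by_cases hy : y ∈ cube c l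
    · have hd : ‖x - y‖ < R := by
        have h2 : dist y c ≤ n * (l / 2) := cube_subset_closedBall c hl hy
        have h3 := dist_triangle_right x y c
        rw [← dist_eq_norm]
        simp only [R]
        linarith
      rw [indicator_of_mem (show ‖x - y‖ ∈ Iio R from hd), norm_div, norm_mul,
        div_eq_mul_inv, Real.norm_of_nonneg (Real.rpow_nonneg (norm_nonneg _) _),
        ← Real.rpow_neg (norm_nonneg _), neg_sub,
        Real.norm_of_nonneg (Real.rpow_nonneg (norm_nonneg _) _)]
      gcongr
      exact (hB y).trans (le_abs_self B)
    · rw [hsupp y hy, zero_div, norm_zero]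
      exact norm_nonneg _

/-- The weak type inequality for the commutator, tested on `f = b^{m(r-1)} w^r` on a cube. -/
lemma testing_inequality (hn : n ≠ 0) {p q r α : ℝ} {m : ℕ} (hpr : p.HolderConjugate r)
    (hα : 0 < α) (hαn : α < n) (hq : 0 < q) (hm : 1 ≤ m) {μ ν : Rn n → ℝ}
    (hν : AEMeasurable ν volume) {C : ℝ≥0∞} {b w : Rn n → ℝ}
    (hbound : ∀ f : Rn n → ℝ, AEStronglyMeasurable f volume →
      MemLp f (ENNReal.ofReal p) (weightMeasure ν) → FracCommDefined α m b f →
        weakLpNorm q (weightMeasure μ) (fracComm α m b f) ≤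
          C * eLpNorm f (ENNReal.ofReal p) (weightMeasure ν))
    {c : Rn n} {l : ℝ} (hl : 0 < l) {S : Set (Rn n)} {d : ℝ} (hd0 : 0 < d)
    (hd : ∀ x ∈ S, ∀ y ∈ cube c l, 0 < ‖x - y‖ ∧ ‖x - y‖ ≤ d)
    (hbm : Measurable b) (hbS : ∀ x ∈ S, b x = 0) {B : ℝ} (hbB : ∀ x, |b x| ≤ B)
    (hb1 : ∀ x ∈ cube c l, 1 ≤ b x)
    (hwm : Measurable w) {W : ℝ} (hw0 : ∀ x, 0 ≤ w x) (hwW : ∀ x, w x ≤ W)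
    (hwν : ∀ x, w x ^ p * ν x ≤ 1) :
    ENNReal.ofReal (d ^ (α - n) / 2 * (∫ y in cube c l, b y ^ (m * r) * w y ^ r) ^ (1 / r)) *
      weightMeasure μ S ^ (1 / q) ≤ C := by
  have hp0 := hpr.pos
  have hr0 := hpr.symm.pos
  have hr1 := hpr.symm.lt
  have hm0 : (0 : ℝ) < m := by exact_mod_cast hm
  have hcc : c ∈ cube c l := fun i => by simpa using (half_pos hl).le
  have hB1 : 1 ≤ B := (hb1 c hcc).trans ((le_abs_self _).trans (hbB c))
  have hW0 : 0 ≤ W := (hw0 c).trans (hwW c)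
  set Q := cube c l with hQ
  have hQm : MeasurableSet Q := measurableSet_cube c l
  set φ : Rn n → ℝ := fun y => b y ^ (m * r) * w y ^ r with hφ
  -- The extremiser for duality: both b^m f and the bound for |f|^p ν reduce to φ, because (r - 1)p
  -- = r and w^p ν ≤ 1.
  set f : Rn n → ℝ := Q.indicator fun y => b y ^ (m * (r - 1)) * w y ^ r with hf
  have hb0 : ∀ y ∈ Q, 0 < b y := fun y hy => zero_lt_one.trans_le (hb1 y hy)
  have hφ0 : ∀ y ∈ Q, 0 ≤ φ y := fun y hy =>
    mul_nonneg (Real.rpow_nonneg (hb0 y hy).le _) (Real.rpow_nonneg (hw0 y) _)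
  have hf0 : ∀ y, 0 ≤ f y := by
    intro y
    refine indicator_nonneg (fun y hy => ?_) y
    exact mul_nonneg (Real.rpow_nonneg (hb0 y hy).le _) (Real.rpow_nonneg (hw0 y) _)
  have hfm : Measurable f := by
    refine Measurable.indicator ?_ hQm
    exact (hbm.pow_const _).mul (hwm.pow_const _)
  have hfB : ∀ y, |f y| ≤ B ^ (m * (r - 1)) * W ^ r := by
    intro y
    rw [abs_of_nonneg (hf0 y)]
    by_cases hy : y ∈ Q
    · rw [hf, indicator_of_mem hy]
      have h1 : b y ≤ B := (le_abs_self _).trans (hbB y)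
      have h2 := hb0 y hy
      have h3 : 0 ≤ m * (r - 1) := by nlinarith
      have := hw0 y
      gcongr
      exact hwW y
    · rw [hf, indicator_of_notMem hy]
      positivity
  have hbf : ∀ y ∈ Q, b y ^ m * f y = φ y := by
    intro y hy
    rw [hf, indicator_of_mem hy, ← mul_assoc, ← Real.rpow_natCast, ← Real.rpow_add (hb0 y hy)]
    simp only [hφ]
    ring_nf
  have hfsupp : ∀ y ∉ Q, f y = 0 := fun y hy => by rw [hf, indicator_of_notMem hy]
  have hint : ∀ x, Integrable (commIntegrand α m b f x) := by
    intro x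
    have h1 : commIntegrand α m b f x =
        fun y => ((b x - b y) ^ m * f y) / ‖x - y‖ ^ ((n : ℝ) - α) := by
      ext y
      rw [commIntegrand, mul_div_assoc]
    rw [h1]
    refine integrable_div_norm_rpow hn hα hl.le (c := c)
      (B := (B + B) ^ m * (B ^ (m * (r - 1)) * W ^ r)) ?_ (fun y => ?_) (fun y hy => ?_) x
    · exact (((measurable_const.sub hbm).pow_const m).mul hfm).aestronglyMeasurable
    · rw [abs_mul, abs_pow]
      have := hfB y
      have : |b x - b y| ≤ B + B := (abs_sub _ _).trans (add_le_add (hbB x) (hbB y))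
      gcongr
    · rw [hfsupp y hy, mul_zero]
  set F : ℝ := ∫ y in Q, φ y with hF
  have hF0 : 0 ≤ F := setIntegral_nonneg hQm hφ0
  -- The final cancellation of F^{1/p} needs F > 0.
  rcases hF0.eq_or_lt with hFz | hFpos
  · rw [← hFz, Real.zero_rpow (by positivity)]
    simp
  have hφB : ∀ y ∈ Q, ‖φ y‖ ≤ B ^ (m * r) * W ^ r := by
    intro y hy
    rw [Real.norm_of_nonneg (hφ0 y hy)]
    have h1 : b y ≤ B := (le_abs_self _).trans (hbB y)
    have h2 := hb0 y hy
    have := hw0 y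
    simp only [hφ]
    gcongr
    exact hwW y
  have hφm : Measurable φ := (hbm.pow_const _).mul (hwm.pow_const _)
  have hφint : IntegrableOn φ Q :=
    Measure.integrableOn_of_bounded (volume_cube_ne_top c l) hφm.aestronglyMeasurable
      ((ae_restrict_iff' hQm).2 (.of_forall hφB))
  have hFl : ENNReal.ofReal F = ∫⁻ y in Q, ENNReal.ofReal (φ y) :=
    ofReal_integral_eq_lintegral_ofReal hφint ((ae_restrict_iff' hQm).2 (.of_forall hφ0))
  -- Since b vanishes at x, the factor (b x - b y)^m is (-1)^m b(y)^m and no cancellation occurs;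
  -- the kernel is at least d^{α-n} because α < n.
  have hlower : ∀ x ∈ S, d ^ (α - n) * F ≤ |fracComm α m b f x| := by
    intro x hx
    have h1 : |fracComm α m b f x| = ∫ y, b y ^ m * f y / ‖x - y‖ ^ ((n : ℝ) - α) := by
      have h2 : fracComm α m b f x =
          (-1) ^ m * ∫ y, b y ^ m * f y / ‖x - y‖ ^ ((n : ℝ) - α) := by
        rw [fracComm, ← integral_const_mul]
        congr 1
        ext y
        rw [commIntegrand, hbS x hx, zero_sub, neg_pow]
        ring
      rw [h2, abs_mul, abs_pow, abs_neg, abs_one, one_pow, one_mul, abs_of_nonneg]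
      refine integral_nonneg fun y => ?_
      by_cases hy : y ∈ Q
      · have := hf0 y
        have := hb0 y hy
        positivity
      · simp [hfsupp y hy]
    have h3 : Integrable fun y => b y ^ m * f y / ‖x - y‖ ^ ((n : ℝ) - α) := by
      refine (hint x).norm.congr (.of_forall fun y => ?_)
      simp only [commIntegrand]
      rw [hbS x hx, zero_sub, norm_mul, norm_pow, norm_neg, norm_div,
        Real.norm_of_nonneg (hf0 y), Real.norm_of_nonneg (Real.rpow_nonneg (norm_nonneg _) _),
        mul_div_assoc]
      by_cases hy : y ∈ Q
      · rw [Real.norm_of_nonneg (hb0 y hy).le]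
      · simp [hfsupp y hy]
    rw [h1, ← setIntegral_eq_integral_of_forall_compl_eq_zero
      (s := Q) (f := fun y => b y ^ m * f y / ‖x - y‖ ^ ((n : ℝ) - α))
      (fun y hy => by simp [hfsupp y hy]), hF, ← integral_const_mul]
    refine setIntegral_mono_on (hφint.const_mul _) h3.integrableOn hQm fun y hy => ?_
    rw [hbf y hy, div_eq_mul_inv, mul_comm (φ y), ← Real.rpow_neg (norm_nonneg _), neg_sub]
    refine mul_le_mul_of_nonneg_right ?_ (hφ0 y hy)
    exact Real.rpow_le_rpow_of_nonpos (hd x hx y hy).1 (hd x hx y hy).2 (by linarith)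
  have hpE : ENNReal.ofReal p ≠ 0 := by simpa using hp0
  have hnorm : eLpNorm f (ENNReal.ofReal p) (weightMeasure ν) ≤ ENNReal.ofReal (F ^ (1 / p)) := by
    rw [eLpNorm_eq_lintegral_rpow_enorm_toReal hpE ENNReal.ofReal_ne_top,
      ENNReal.toReal_ofReal hp0.le, ← ENNReal.ofReal_rpow_of_pos hFpos, hFl]
    refine ENNReal.rpow_le_rpow ?_ (by positivity)
    rw [weightMeasure, lintegral_withDensity_eq_lintegral_mul₀ hν.ennreal_ofReal
      (hfm.enorm.pow_const p).aemeasurable, ← lintegral_indicator hQm]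
    refine lintegral_mono fun y => ?_
    by_cases hy : y ∈ Q
    · rw [indicator_of_mem hy, Pi.mul_apply, Real.enorm_of_nonneg (hf0 y),
        ENNReal.ofReal_rpow_of_nonneg (hf0 y) hp0.le, mul_comm,
        ← ENNReal.ofReal_mul (Real.rpow_nonneg (hf0 y) _)]
      refine ENNReal.ofReal_le_ofReal ?_
      have hby := hb0 y hy
      rw [hf, indicator_of_mem hy, Real.mul_rpow (by positivity) (Real.rpow_nonneg (hw0 y) _),
        ← Real.rpow_mul hby.le, ← Real.rpow_mul (hw0 y)]
      have e1 : (m : ℝ) * (r - 1) * p = m * r := by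
        have h4 := hpr.symm.sub_one_mul_conj
        rw [mul_assoc, h4]
      have e2 : r * p = r + p := by
        have := hpr.symm.mul_eq_add
        linarith
      rw [e1, e2, Real.rpow_add_of_nonneg (hw0 y) hr0.le hp0.le]
      simp only [hφ]
      have h5 := hwν y
      have h6 : 0 ≤ b y ^ (m * r) * w y ^ r := hφ0 y hy
      calc b y ^ (m * r) * (w y ^ r * w y ^ p) * ν y
          = b y ^ (m * r) * w y ^ r * (w y ^ p * ν y) := by ring
        _ ≤ b y ^ (m * r) * w y ^ r := mul_le_of_le_one_right h6 h5
    · rw [indicator_of_notMem hy, Pi.mul_apply, hfsupp y hy]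
      simp [hp0]
  have hmem : MemLp f (ENNReal.ofReal p) (weightMeasure ν) := by
    refine ⟨hfm.aestronglyMeasurable, hnorm.trans_lt ENNReal.ofReal_lt_top⟩
  have hmain := hbound f hfm.aestronglyMeasurable hmem (.of_forall hint)
  have hT : 0 < d ^ (α - n) * F := by positivity
  -- The weak norm uses the strict set {|g| > t}, so t is taken to be half the lower bound.
  have hweak : ENNReal.ofReal (d ^ (α - n) * F / 2) * weightMeasure μ S ^ (1 / q) ≤
      weakLpNorm q (weightMeasure μ) (fracComm α m b f) := by
    refine le_trans ?_ (le_iSup₂_of_le (d ^ (α - n) * F / 2).toNNReal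
      (by simpa using half_pos hT) le_rfl)
    rw [ENNReal.ofReal]
    gcongr
    intro x hx
    have := hlower x hx
    simp only [mem_ofPred_eq]
    rw [Real.coe_toNNReal _ (half_pos hT).le]
    linarith
  have hsplit : ENNReal.ofReal (d ^ (α - n) * F / 2) =
      ENNReal.ofReal (d ^ (α - n) / 2 * F ^ (1 / r)) * ENNReal.ofReal (F ^ (1 / p)) := by
    rw [← ENNReal.ofReal_mul (by positivity), mul_assoc, ← Real.rpow_add hFpos]
    have : 1 / r + 1 / p = 1 := by
      have := hpr.inv_add_inv_eq_one
      rw [one_div, one_div]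
      linarith
    rw [this, Real.rpow_one]
    congr 1
    ring
  have hfin := hweak.trans (hmain.trans (mul_le_mul_right hnorm C))
  rw [hsplit, mul_right_comm] at hfin
  have hFp : ENNReal.ofReal (F ^ (1 / p)) ≠ 0 := by
    simp only [ne_eq, ENNReal.ofReal_eq_zero, not_le]
    positivity
  exact (ENNReal.mul_le_mul_iff_left hFp ENNReal.ofReal_ne_top).1 hfin

end Testing

/-! ### Luxemburg averages and the choice of b -/

section Orlicz

variable {n : ℕ}

lemma measurable_logBump (r s : ℝ) : Measurable (logBump r s) := by
  unfold logBump
  refine Measurable.ite (measurableSet_singleton ∞) measurable_const ?_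
  fun_prop

lemma logBump_ofReal (r s : ℝ) {t : ℝ} (ht : 0 ≤ t) :
    logBump r s (ENNReal.ofReal t) =
      ENNReal.ofReal (t ^ r * Real.log (Real.exp 1 + t) ^ s) := by
  rw [logBump, if_neg ENNReal.ofReal_ne_top, ENNReal.toReal_ofReal ht]

lemma one_le_log_exp_add {t : ℝ} (ht : 0 ≤ t) : 1 ≤ Real.log (Real.exp 1 + t) := by
  rw [Real.le_log_iff_exp_le (by positivity)]
  linarith

/-- For finite h the truncations are eventually constant. For h = ∞ the logarithmic factor is at
least 1, so the power t^r alone forces divergence. -/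
lemma tendsto_logBump_truncation {r s : ℝ} (hr : 0 < r) (hs : 0 ≤ s) {σ : ℝ≥0} (hσ : 0 < σ)
    (h : ℝ≥0∞) :
    Tendsto (fun N : ℕ => logBump r s (min h ((N + 1 : ℕ) : ℝ≥0∞) / σ)) atTop
      (nhds (logBump r s (h / σ))) := by
  rcases eq_or_ne h ∞ with rfl | hh
  · rw [ENNReal.top_div_coe, logBump, if_pos rfl]
    have h1 : Tendsto (fun N : ℕ => ENNReal.ofReal ((((N + 1 : ℕ) : ℝ) / σ) ^ r)) atTop
        (nhds ∞) := by
      refine ENNReal.tendsto_ofReal_atTop.comp ((tendsto_rpow_atTop hr).comp ?_)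
      refine Tendsto.atTop_div_const (by exact_mod_cast hσ) ?_
      exact tendsto_natCast_atTop_atTop.comp (tendsto_add_atTop_nat 1)
    refine tendsto_nhds_top_mono h1 (.of_forall fun N => ?_)
    have h0 : (0 : ℝ) ≤ ((N + 1 : ℕ) : ℝ) / σ := by positivity
    have h2 : min ∞ ((N + 1 : ℕ) : ℝ≥0∞) / σ = ENNReal.ofReal (((N + 1 : ℕ) : ℝ) / σ) := by
      rw [min_eq_right le_top, ENNReal.ofReal_div_of_pos (by exact_mod_cast hσ),
        ENNReal.ofReal_natCast, ENNReal.ofReal_coe_nnreal]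
    simp only [h2, logBump_ofReal _ _ h0]
    refine ENNReal.ofReal_le_ofReal (le_mul_of_one_le_right (by positivity) ?_)
    exact Real.one_le_rpow (one_le_log_exp_add h0) hs
  · obtain ⟨N₀, hN₀⟩ := ENNReal.exists_nat_gt hh
    refine tendsto_const_nhds.congr' ?_
    filter_upwards [eventually_ge_atTop N₀] with N hN
    rw [min_eq_left (hN₀.le.trans _)]
    exact_mod_cast hN.trans (Nat.le_succ N)

/-- Fatou's lemma applied to the pointwise convergence of the truncations. -/
lemma setLIntegral_logBump_le_of_truncations {r s : ℝ} (hr : 0 < r) (hs : 0 ≤ s) {σ : ℝ≥0}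
    (hσ : 0 < σ) {h : Rn n → ℝ≥0∞} (hh : Measurable h) {Q : Set (Rn n)} {V : ℝ≥0∞}
    (hV : ∀ N : ℕ, ∫⁻ x in Q, logBump r s (min (h x) ((N + 1 : ℕ) : ℝ≥0∞) / σ) ≤ V) :
    ∫⁻ x in Q, logBump r s (h x / σ) ≤ V := by
  have h1 : ∀ x, logBump r s (h x / σ) =
      liminf (fun N : ℕ => logBump r s (min (h x) ((N + 1 : ℕ) : ℝ≥0∞) / σ)) atTop := fun x =>
    (tendsto_logBump_truncation hr hs hσ (h x)).liminf_eq.symm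
  simp_rw [h1]
  refine (lintegral_liminf_le fun N => ?_).trans ?_
  · exact (measurable_logBump r s).comp ((hh.min measurable_const).div_const _)
  · exact liminf_le_of_frequently_le' (.of_forall hV)

/-- The constant comparing `log (e + k / s)` with `1 + log⁺ (v k^r / a)`. -/
noncomputable def logConst (r v : ℝ) : ℝ := Real.log (Real.exp 1 + (1 / v) ^ (1 / r))

lemma one_le_logConst (r : ℝ) {v : ℝ} (hv : 0 < v) : 1 ≤ logConst r v :=
  one_le_log_exp_add (by positivity)

/-- With U the maximum on the right, k/s ≤ (k^r/a)^{1/r} ≤ v^{-1/r} U^{1/r} ≤ v^{-1/r} U, as U ≥ 1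
and r ≥ 1. Hence e + k/s ≤ (e + v^{-1/r}) U, and the logarithm of the product splits. -/
lemma log_exp_add_div_le {r v a k s : ℝ} (hr : 1 ≤ r) (hv : 0 < v) (ha : 0 < a) (hk : 0 ≤ k)
    (hs : a ^ (1 / r) ≤ s) :
    Real.log (Real.exp 1 + k / s) ≤
      logConst r v * (1 + Real.log (max (v * (k ^ r / a)) 1)) := by
  set U := max (v * (k ^ r / a)) 1 with hU
  have hU1 : 1 ≤ U := le_max_right _ _
  have ha' : 0 < a ^ (1 / r) := by positivity
  have hs0 : 0 < s := ha'.trans_le hs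
  have h1 : k / s ≤ (1 / v) ^ (1 / r) * U := by
    calc k / s ≤ k / a ^ (1 / r) := by gcongr
      _ = (k ^ r / a) ^ (1 / r) := by
          rw [Real.div_rpow (by positivity) ha.le, ← Real.rpow_mul hk, mul_one_div_cancel
            (by linarith), Real.rpow_one]
      _ ≤ (1 / v * U) ^ (1 / r) := by
          gcongr
          rw [one_div, ← div_eq_inv_mul, le_div_iff₀ hv, mul_comm]
          exact le_max_left _ _
      _ = (1 / v) ^ (1 / r) * U ^ (1 / r) := Real.mul_rpow (by positivity) (by positivity)
      _ ≤ (1 / v) ^ (1 / r) * U := by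
          gcongr
          refine Real.rpow_le_self_of_one_le hU1 ?_
          rw [div_le_one (by linarith)]
          exact hr
  have hc : 0 < Real.exp 1 + (1 / v) ^ (1 / r) := by positivity
  have h2 : Real.exp 1 + k / s ≤ (Real.exp 1 + (1 / v) ^ (1 / r)) * U := by
    have : Real.exp 1 ≤ Real.exp 1 * U := le_mul_of_one_le_right (Real.exp_pos 1).le hU1
    linarith
  have h3 : 1 ≤ logConst r v := one_le_logConst r hv
  have h4 : 0 ≤ Real.log U := Real.log_nonneg hU1
  calc Real.log (Real.exp 1 + k / s)
      ≤ Real.log ((Real.exp 1 + (1 / v) ^ (1 / r)) * U) := by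
        refine Real.log_le_log ?_ h2
        positivity
    _ = logConst r v + Real.log U := by rw [Real.log_mul hc.ne' (by linarith), logConst]
    _ ≤ _ := by nlinarith

/-- A logarithmic weight dominates the Luxemburg average. -/
lemma setLIntegral_logBump_le {r v : ℝ} (hr : 1 < r) (hv : 0 < v) (m : ℕ) {Q : Set (Rn n)}
    (hQ : MeasurableSet Q) (hQ0 : volume Q ≠ 0) (hQt : volume Q ≠ ∞)
    {b w : Rn n → ℝ} (hb1 : ∀ x ∈ Q, 1 ≤ b x) (hw0 : ∀ x, 0 ≤ w x)
    (hint : IntegrableOn (fun y => b y ^ (m * r) * w y ^ r) Q)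
    (hint' : IntegrableOn (fun y => w y ^ r) Q) {a : ℝ} (ha : 0 < a)
    (haQ : a = (∫ y in Q, w y ^ r) / volume.real Q)
    (hb : ∀ᵐ x ∂volume.restrict Q, 1 + Real.log (max (v * (w x ^ r / a)) 1) ≤ b x)
    {s : ℝ≥0}
    (hs : logConst r v ^ m *
      ((∫ y in Q, b y ^ (m * r) * w y ^ r) / volume.real Q) ^ (1 / r) ≤ s) :
    ∫⁻ x in Q, logBump r (m * r) (ENNReal.ofReal (w x) / s) ≤ volume Q := by
  have hr0 : 0 < r := by linarith
  set V := volume.real Q with hV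
  have hV0 : 0 < V := ENNReal.toReal_pos hQ0 hQt
  set F := ∫ y in Q, b y ^ (m * r) * w y ^ r with hF
  set Λ := logConst r v with hΛ
  have hΛ1 : 1 ≤ Λ := one_le_logConst r hv
  have haF : a ≤ F / V := by
    rw [haQ]
    gcongr
    refine setIntegral_mono_on hint' hint hQ fun y hy => ?_
    refine le_mul_of_one_le_left (Real.rpow_nonneg (hw0 y) _) ?_
    exact Real.one_le_rpow (hb1 y hy) (by positivity)
  have hFV : 0 < F / V := ha.trans_le haF
  -- The pointwise logarithmic bound requires this; it follows from b ≥ 1, which gives a ≤ F/V, and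
  -- Λ ≥ 1.
  have has : a ^ (1 / r) ≤ s := by
    calc a ^ (1 / r) ≤ (F / V) ^ (1 / r) := by gcongr
      _ ≤ Λ ^ m * (F / V) ^ (1 / r) :=
          le_mul_of_one_le_left (by positivity) (one_le_pow₀ hΛ1)
      _ ≤ s := hs
  have hs0 : (0 : ℝ) < s := lt_of_lt_of_le (by positivity) has
  have hsr : Λ ^ (m * r) * (F / V) ≤ (s : ℝ) ^ r := by
    have h1 : (Λ ^ m * (F / V) ^ (1 / r)) ^ r ≤ (s : ℝ) ^ r := by gcongr
    rwa [Real.mul_rpow (by positivity) (by positivity), ← Real.rpow_natCast,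
      ← Real.rpow_mul (by positivity), ← Real.rpow_mul hFV.le, one_div_mul_cancel hr0.ne',
      Real.rpow_one] at h1
  calc ∫⁻ x in Q, logBump r (m * r) (ENNReal.ofReal (w x) / s)
      ≤ ∫⁻ x in Q, ENNReal.ofReal (Λ ^ (m * r) / (s : ℝ) ^ r * (b x ^ (m * r) * w x ^ r)) := by
        refine lintegral_mono_ae ?_
        filter_upwards [hb, ae_restrict_mem hQ] with x hx hxQ
        have hw := hw0 x
        have hb0 : 0 < b x := zero_lt_one.trans_le (hb1 x hxQ)
        have h1 : ENNReal.ofReal (w x) / s = ENNReal.ofReal (w x / s) := by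
          rw [ENNReal.ofReal_div_of_pos hs0, ENNReal.ofReal_coe_nnreal]
        rw [h1, logBump_ofReal _ _ (by positivity)]
        refine ENNReal.ofReal_le_ofReal ?_
        have h2 : Real.log (Real.exp 1 + w x / s) ≤ Λ * b x :=
          (log_exp_add_div_le hr.le hv ha hw has).trans (by gcongr)
        have h3 := one_le_log_exp_add (t := w x / s) (by positivity)
        calc (w x / s) ^ r * Real.log (Real.exp 1 + w x / s) ^ (m * r)
            ≤ (w x / s) ^ r * (Λ * b x) ^ (m * r) := by gcongr
          _ = _ := by
              rw [Real.div_rpow hw hs0.le, Real.mul_rpow (by positivity) hb0.le]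
              ring
    _ = ENNReal.ofReal (∫ x in Q, Λ ^ (m * r) / (s : ℝ) ^ r * (b x ^ (m * r) * w x ^ r)) := by
        refine (ofReal_integral_eq_lintegral_ofReal (hint.const_mul _) ?_).symm
        filter_upwards [ae_restrict_mem hQ] with x hxQ
        have hw := hw0 x
        have hb0 : 0 < b x := zero_lt_one.trans_le (hb1 x hxQ)
        simp only [Pi.zero_apply]
        positivity
    _ ≤ ENNReal.ofReal V := by
        refine ENNReal.ofReal_le_ofReal ?_
        rw [integral_const_mul, ← hF, div_mul_eq_mul_div, div_le_iff₀ (by positivity)]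
        rw [mul_div_assoc', div_le_iff₀ hV0] at hsr
        linarith
    _ = volume Q := by rw [hV, Measure.real, ENNReal.ofReal_toReal hQt]

/-- A `BMO` function with controlled norm, vanishing away from a cube and dominating the
logarithm of a given function on that cube. -/
lemma exists_bmo_dominating_log (hn : n ≠ 0) (c : Rn n) {l : ℝ} (hl : 0 < l) {S : Set (Rn n)}
    (hS : ∀ x ∈ S, ∀ y ∈ cube c l, l ≤ dist y x) {ψ : Rn n → ℝ} (hψm : Measurable ψ)
    (hψ0 : ∀ x, 0 ≤ ψ x) {B : ℝ} (hψB : ∀ x, ψ x ≤ B) {a : ℝ} (ha : 0 < a)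
    (haQ : a = (∫ y in cube c l, ψ y) / volume.real (cube c l)) :
    ∃ b : Rn n → ℝ, Measurable b ∧ (∀ x ∈ S, b x = 0) ∧ (∃ B', ∀ x, |b x| ≤ B') ∧
      MemBMO b ∧ bmoNorm b ≤ 2 * (oscConst n + 1) ∧ (∀ x ∈ cube c l, 1 ≤ b x) ∧
      ∀ᵐ x ∂volume.restrict (cube c l),
        1 + Real.log (max ((unitBallVolume n).toReal * (ψ x / a)) 1) ≤ b x := by
  set Q := cube c l with hQ
  have hQm : MeasurableSet Q := measurableSet_cube c l
  have hQ0 : volume Q ≠ 0 := volume_cube_pos c hl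
  have hQt : volume Q ≠ ∞ := volume_cube_ne_top c l
  have hV0 : 0 < volume.real Q := ENNReal.toReal_pos hQ0 hQt
  set v := (unitBallVolume n).toReal with hv
  have hv0 : 0 < v := ENNReal.toReal_pos (unitBallVolume_ne_zero n) (unitBallVolume_ne_top n)
  -- Dividing by the mean a gives g the mass v|Q| = v l^n, exactly the volume of a ball of radius l;
  -- this is what makes Mg ≤ 1 on S.
  set g : Rn n → ℝ≥0∞ := Q.indicator fun x => ENNReal.ofReal (v * (ψ x / a)) with hg
  have hgm : Measurable g := by
    refine Measurable.indicator ?_ hQm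
    fun_prop
  have hψint : IntegrableOn ψ Q :=
    Measure.integrableOn_of_bounded (M := B) hQt hψm.aestronglyMeasurable
      (.of_forall fun x => by rw [Real.norm_of_nonneg (hψ0 x)]; exact hψB x)
  have hgI : ∫⁻ x, g x = unitBallVolume n * volume Q := by
    rw [hg, lintegral_indicator hQm, ← ofReal_integral_eq_lintegral_ofReal
      ((hψint.div_const a).const_mul v)
      (.of_forall fun x => mul_nonneg hv0.le (div_nonneg (hψ0 x) ha.le)),
      integral_const_mul, integral_div, ENNReal.ofReal_mul hv0.le, hv,
      ENNReal.ofReal_toReal (unitBallVolume_ne_top n)]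
    congr 1
    have : (∫ x in Q, ψ x) / a = volume.real Q := by
      rw [div_eq_iff ha.ne', haQ, mul_div_cancel₀ _ hV0.ne']
    rw [this, Measure.real, ENNReal.ofReal_toReal hQt]
  have hgIt : ∫⁻ x, g x ≠ ∞ := by
    rw [hgI]
    exact ENNReal.mul_ne_top (unitBallVolume_ne_top n) hQt
  have hgB : ∀ x, g x ≤ ENNReal.ofReal (v * (B / a)) := by
    intro x
    refine (indicator_le_self Q _ x).trans ?_
    refine ENNReal.ofReal_le_ofReal ?_
    gcongr
    exact hψB x
  have hMB := maximalFn_le_of_forall_le hgB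
  have hMfin : ∀ x, maximalFn g x ≠ ∞ := fun x =>
    ne_top_of_le_ne_top ENNReal.ofReal_ne_top (hMB x)
  have hMS : ∀ x ∈ S, maximalFn g x ≤ 1 := by
    intro x hx
    refine (maximalFn_le_of_dist (s := Q) (fun y hy => indicator_of_notMem hy _)
      (d := l) (hS x hx)).trans ?_
    rw [hgI, hQ, volume_cube, mul_comm]
    exact ENNReal.div_self_le_one
  set b₁ : Rn n → ℝ := fun x => Real.log (max (maximalFn g x) 1).toReal with hb₁
  -- The added indicator secures b ≥ 1 on Q and raises the oscillation constant by at most 1.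
  set b₂ : Rn n → ℝ := Q.indicator fun _ => 1 with hb₂
  have hb₁m : Measurable b₁ :=
    Real.measurable_log.comp ((measurable_maximalFn hgm).max measurable_const).ennreal_toReal
  have hb₂m : Measurable b₂ := measurable_const.indicator hQm
  have hmax1 : ∀ x, 1 ≤ (max (maximalFn g x) 1).toReal := by
    intro x
    rw [← ENNReal.toReal_one]
    exact ENNReal.toReal_mono (by simp [hMfin x]) (le_max_right _ _)
  have hb₁0 : ∀ x, 0 ≤ b₁ x := fun x => Real.log_nonneg (hmax1 x)
  have hb₂0 : ∀ x, 0 ≤ b₂ x := fun x => indicator_nonneg (fun _ _ => zero_le_one) x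
  have hb₂1 : ∀ x, b₂ x ≤ 1 := fun x =>
    indicator_le' (fun _ _ => le_rfl) (fun _ _ => zero_le_one) x
  obtain ⟨B', hB'⟩ : ∃ B', ∀ x, |b₁ x + b₂ x| ≤ B' := by
    refine ⟨Real.log (max (ENNReal.ofReal (v * (B / a))) 1).toReal + 1, fun x => ?_⟩
    rw [abs_of_nonneg (add_nonneg (hb₁0 x) (hb₂0 x))]
    refine add_le_add (Real.log_le_log (by linarith [hmax1 x]) ?_) (hb₂1 x)
    exact ENNReal.toReal_mono (by simp) (max_le_max_right 1 (hMB x))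
  have hbm : Measurable fun x => b₁ x + b₂ x := hb₁m.add hb₂m
  have hloc : LocallyIntegrable (fun x => b₁ x + b₂ x) volume := by
    refine (locallyIntegrable_const B').mono hbm.aestronglyMeasurable (.of_forall fun x => ?_)
    exact (hB' x).trans (le_abs_self _)
  have hbmo : bmoNorm (fun x => b₁ x + b₂ x) ≤ 2 * (oscConst n + 1) := by
    refine bmoNorm_le_of_oscillation hloc fun c' l' hl' => ?_
    obtain ⟨t, ht⟩ := oscillation_log_maximalFn hn hgm hMfin c' hl'
    refine ⟨t, ?_⟩
    calc ∫⁻ x in cube c' l', ‖b₁ x + b₂ x - t‖ₑ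
        ≤ ∫⁻ x in cube c' l', (‖b₁ x - t‖ₑ + 1) := by
          refine lintegral_mono fun x => ?_
          rw [add_sub_right_comm]
          refine (enorm_add_le _ _).trans ?_
          gcongr
          rw [Real.enorm_of_nonneg (hb₂0 x)]
          exact ENNReal.ofReal_le_one.2 (hb₂1 x)
      _ = (∫⁻ x in cube c' l', ‖b₁ x - t‖ₑ) + volume (cube c' l') := by
          rw [lintegral_add_right _ measurable_const, setLIntegral_const, one_mul]
      _ ≤ _ := by
          rw [add_mul, one_mul]
          gcongr
  refine ⟨fun x => b₁ x + b₂ x, hbm, fun x hx => ?_, ⟨B', hB'⟩, ⟨hloc, hbmo.trans_lt ?_⟩, hbmo,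
    fun x hx => ?_, ?_⟩
  · have hxQ : x ∉ Q := fun h => by
      have := hS x hx x h
      rw [dist_self] at this
      linarith
    simp [hb₁, hb₂, hxQ, max_eq_right (hMS x hx)]
  · have := oscConst_ne_top n
    finiteness
  · have h1 : b₂ x = 1 := indicator_of_mem hx _
    linarith [hb₁0 x]
  · filter_upwards [ae_restrict_mem hQm, ae_restrict_of_ae (ae_le_maximalFn hgm hgIt)]
      with x hx hgx
    have h1 : b₂ x = 1 := indicator_of_mem hx _
    rw [h1, add_comm]
    gcongr
    refine Real.log_le_log (by positivity) ?_
    rw [hg, indicator_of_mem hx] at hgx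
    rw [ENNReal.toReal_max (hMfin x) ENNReal.one_ne_top, ENNReal.toReal_one]
    refine max_le_max_right 1 ?_
    rwa [← ENNReal.ofReal_le_iff_le_toReal (hMfin x)]

end Orlicz

/-! ### Shifted cubes, truncated weights and scaling -/

section Necessity

variable {n : ℕ}

/-- The translate of a centre by twice the side length in the first direction. -/
noncomputable def shiftedCentre (i : Fin n) (c : Rn n) (l : ℝ) : Rn n :=
  c + EuclideanSpace.single i (2 * l)

lemma shiftedCentre_apply_self (i : Fin n) (c : Rn n) (l : ℝ) :
    shiftedCentre i c l i = c i + 2 * l := by simp [shiftedCentre]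

lemma abs_shiftedCentre_sub_le (i : Fin n) (c : Rn n) {l : ℝ} (hl : 0 ≤ l) (j : Fin n) :
    |shiftedCentre i c l j - c j| ≤ 2 * l := by
  rcases eq_or_ne j i with rfl | h
  · rw [shiftedCentre_apply_self, add_sub_cancel_left, abs_of_nonneg (by positivity)]
  · simp [shiftedCentre, h, hl]

/-- In coordinate i the centres are 2l apart and each half side is l/2, which leaves a gap of l. -/
lemma le_dist_of_mem_shifted {i : Fin n} {c : Rn n} {l : ℝ} {x y : Rn n}
    (hx : x ∈ cube (shiftedCentre i c l) l) (hy : y ∈ cube c l) : l ≤ dist y x := by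
  refine le_trans ?_ (abs_sub_le_dist y x i)
  have h1 := abs_le.1 (hx i)
  have h2 := abs_le.1 (hy i)
  rw [shiftedCentre_apply_self] at h1
  rw [abs_sub_comm]
  refine le_trans ?_ (le_abs_self _)
  linarith [h1.1, h2.2]

lemma dist_le_of_mem_shifted {i : Fin n} {c : Rn n} {l : ℝ} (hl : 0 ≤ l) {x y : Rn n}
    (hx : x ∈ cube (shiftedCentre i c l) l) (hy : y ∈ cube c l) : dist x y ≤ n * (3 * l) := by
  refine dist_le_of_forall_abs_le (by positivity) fun j => ?_
  have h1 := abs_le.1 (hx j)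
  have h2 := abs_le.1 (hy j)
  have h3 := abs_le.1 (abs_shiftedCentre_sub_le i c hl j)
  rw [abs_le]
  constructor <;> linarith [h1.1, h1.2, h2.1, h2.2, h3.1, h3.2]

/-- The original cube reaches at most 5l/2 from the shifted centre in each coordinate, so the
eightfold dilate, of half side 4l, contains it: three doublings. -/
lemma weightMeasure_cube_le_of_doubling {μ : Rn n → ℝ} {D : ℝ≥0}
    (hD : ∀ (c : Rn n) (l : ℝ), 0 < l →
      weightMeasure μ (cube c (2 * l)) ≤ D * weightMeasure μ (cube c l))
    (i : Fin n) (c : Rn n) {l : ℝ} (hl : 0 < l) :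
    weightMeasure μ (cube c l) ≤ D ^ 3 * weightMeasure μ (cube (shiftedCentre i c l) l) := by
  have hsub : cube c l ⊆ cube (shiftedCentre i c l) (2 * (2 * (2 * l))) := by
    intro y hy j
    have h2 := abs_le.1 (hy j)
    have h3 := abs_le.1 (abs_shiftedCentre_sub_le i c hl.le j)
    rw [abs_le]
    constructor <;> linarith [h2.1, h2.2, h3.1, h3.2]
  calc weightMeasure μ (cube c l)
      ≤ weightMeasure μ (cube (shiftedCentre i c l) (2 * (2 * (2 * l)))) := measure_mono hsub
    _ ≤ D * (D * (D * weightMeasure μ (cube (shiftedCentre i c l) l))) := by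
        refine (hD _ _ (by positivity)).trans ?_
        gcongr
        refine (hD _ _ (by positivity)).trans ?_
        gcongr
        exact hD _ _ hl
    _ = _ := by ring

lemma weightMeasure_cube_ne_top {μ : Rn n → ℝ} (hμ : IsWeight μ) (c : Rn n) {l : ℝ}
    (hl : 0 ≤ l) : weightMeasure μ (cube c l) ≠ ∞ := by
  rw [weightMeasure, withDensity_apply _ (measurableSet_cube c l)]
  have h : IntegrableOn μ (cube c l) :=
    (hμ.locallyIntegrable.integrableOn_isCompact
      (isCompact_closedBall c (n * (l / 2)))).mono_set (cube_subset_closedBall c hl)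
  exact (Integrable.lintegral_lt_top h).ne

lemma avgLpNorm_weight {μ : Rn n → ℝ} {q : ℝ} (hq : 0 < q) (c : Rn n) (l : ℝ) :
    avgLpNorm q (cube c l) (fun x => ENNReal.ofReal (μ x) ^ (1 / q)) =
      (weightMeasure μ (cube c l) / volume (cube c l)) ^ (1 / q) := by
  have h : ∀ x, (ENNReal.ofReal (μ x) ^ (1 / q)) ^ q = ENNReal.ofReal (μ x) := by
    intro x
    rw [← ENNReal.rpow_mul, one_div_mul_cancel hq.ne', ENNReal.rpow_one]
  rw [avgLpNorm, setLAverage_eq, weightMeasure, withDensity_apply _ (measurableSet_cube c l)]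
  simp_rw [h]

/-- The truncated test functions. -/
noncomputable def truncatedWeight (ν : Rn n → ℝ) (p : ℝ) (N : ℕ) (x : Rn n) : ℝ :=
  (min (ENNReal.ofReal (ν x) ^ (-(1 / p))) ((N + 1 : ℕ) : ℝ≥0∞)).toReal

lemma ofReal_truncatedWeight (ν : Rn n → ℝ) (p : ℝ) (N : ℕ) (x : Rn n) :
    ENNReal.ofReal (truncatedWeight ν p N x) =
      min (ENNReal.ofReal (ν x) ^ (-(1 / p))) ((N + 1 : ℕ) : ℝ≥0∞) :=
  ENNReal.ofReal_toReal (ne_top_of_le_ne_top (ENNReal.natCast_ne_top _) (min_le_right _ _))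

lemma measurable_truncatedWeight {ν : Rn n → ℝ} (hν : Measurable ν) (p : ℝ) (N : ℕ) :
    Measurable (truncatedWeight ν p N) :=
  ((hν.ennreal_ofReal.pow_const _).min measurable_const).ennreal_toReal

lemma truncatedWeight_pos (ν : Rn n → ℝ) {p : ℝ} (hp : 0 < p) (N : ℕ) (x : Rn n) :
    0 < truncatedWeight ν p N x := by
  refine ENNReal.toReal_pos ?_
    (ne_top_of_le_ne_top (ENNReal.natCast_ne_top (N + 1)) (min_le_right _ _))
  refine (lt_min ?_ ?_).ne'
  · rw [ENNReal.rpow_neg, ENNReal.inv_pos]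
    exact ENNReal.rpow_ne_top_of_nonneg (by positivity) ENNReal.ofReal_ne_top
  · exact_mod_cast Nat.succ_pos N

lemma truncatedWeight_le (ν : Rn n → ℝ) (p : ℝ) (N : ℕ) (x : Rn n) :
    truncatedWeight ν p N x ≤ N + 1 := by
  have h := ENNReal.toReal_mono (ENNReal.natCast_ne_top (N + 1))
    (min_le_right (ENNReal.ofReal (ν x) ^ (-(1 / p))) ((N + 1 : ℕ) : ℝ≥0∞))
  rw [ENNReal.toReal_natCast] at h
  exact_mod_cast h

lemma truncatedWeight_rpow_mul_le (ν : Rn n → ℝ) {p : ℝ} (hp : 0 < p) (N : ℕ) (x : Rn n) :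
    truncatedWeight ν p N x ^ p * ν x ≤ 1 := by
  have hw := (truncatedWeight_pos ν hp N x).le
  rcases le_or_gt (ν x) 0 with h | h
  · exact (mul_nonpos_of_nonneg_of_nonpos (Real.rpow_nonneg hw p) h).trans zero_le_one
  · have h1 : truncatedWeight ν p N x ≤ ν x ^ (-(1 / p)) := by
      have h2 := (ofReal_truncatedWeight ν p N x).le.trans (min_le_left _ _)
      rw [ENNReal.ofReal_rpow_of_pos h] at h2
      exact (ENNReal.ofReal_le_ofReal_iff (by positivity)).1 h2
    calc truncatedWeight ν p N x ^ p * ν x ≤ (ν x ^ (-(1 / p))) ^ p * ν x := by gcongr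
      _ = 1 := by
          rw [← Real.rpow_mul h.le, neg_mul, one_div_mul_cancel hp.ne', Real.rpow_neg_one,
            inv_mul_cancel₀ h.ne']

/-- The scaling identity between the bump quantity and the tested inequality on a cube of side
length `l`. -/
lemma scaling_identity {p r α : ℝ} (hpr : p.HolderConjugate r) (hn : n ≠ 0) {l F : ℝ}
    (hl : 0 < l) (hF : 0 ≤ F) :
    (l ^ n) ^ (α / n - 1 / p) * (F / l ^ n) ^ (1 / r) =
      2 * (n * 3) ^ (n - α) * ((n * (3 * l)) ^ (α - n) / 2 * F ^ (1 / r)) := by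
  have hn0 : (0 : ℝ) < n := by positivity
  have hr : 1 / p + 1 / r = 1 := by
    have := hpr.inv_add_inv_eq_one
    rw [one_div, one_div]
    linarith
  have hV : 0 < l ^ n := by positivity
  rw [Real.div_rpow hF hV.le, ← mul_assoc (n : ℝ) 3 l, Real.mul_rpow (by positivity) hl.le]
  have h1 : ((n : ℝ) * 3) ^ (n - α) * ((n : ℝ) * 3) ^ (α - n) = 1 := by
    rw [← Real.rpow_add (by positivity)]
    simp
  have h2 : (l ^ n) ^ (α / n - 1 / p) / (l ^ n) ^ (1 / r) = l ^ (α - n) := by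
    rw [← Real.rpow_sub hV, ← Real.rpow_natCast, ← Real.rpow_mul hl.le]
    congr 1
    have : α / n - 1 / p - 1 / r = α / n - 1 := by linarith
    rw [this]
    field_simp
  calc (l ^ n) ^ (α / n - 1 / p) * (F ^ (1 / r) / (l ^ n) ^ (1 / r))
      = (l ^ n) ^ (α / n - 1 / p) / (l ^ n) ^ (1 / r) * F ^ (1 / r) := by ring
    _ = l ^ (α - n) * F ^ (1 / r) := by rw [h2]
    _ = ((n : ℝ) * 3) ^ (n - α) * ((n : ℝ) * 3) ^ (α - n) * (l ^ (α - n) * F ^ (1 / r)) := by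
        rw [h1, one_mul]
    _ = _ := by ring

end Necessity

/-! ### Assembling the bump condition -/

section Main

variable {n : ℕ}

/-- The bound for the bump quantity in terms of the weak type constant `C` and the doubling
constant `D`. -/
noncomputable def bumpBound (n : ℕ) (q r α : ℝ) (m : ℕ) (C D : ℝ≥0) : ℝ≥0∞ :=
  ENNReal.ofReal (logConst r (unitBallVolume n).toReal ^ m * (2 * (n * 3) ^ (n - α))) *
    ((D : ℝ≥0∞) ^ 3) ^ (1 / q) * (C * (2 * (oscConst n + 1)) ^ m) + 1

lemma bumpBound_ne_top (n : ℕ) {q : ℝ} (hq : 0 < q) (r α : ℝ) (m : ℕ) (C D : ℝ≥0) :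
    bumpBound n q r α m C D ≠ ∞ := by
  have := oscConst_ne_top n
  have h : ((D : ℝ≥0∞) ^ 3) ^ (1 / q) ≠ ∞ :=
    ENNReal.rpow_ne_top_of_nonneg (by positivity) (by finiteness)
  unfold bumpBound
  finiteness

/-- The bump estimate for truncated weights on one cube. -/
lemma weight_mul_average_le {p q r α : ℝ} {m : ℕ} (hpr : p.HolderConjugate r) (hq : 0 < q)
    (hα : 0 < α) (hαn : α < n) (hm : 1 ≤ m) {μ ν : Rn n → ℝ} (hν : Measurable ν) {C D : ℝ≥0}
    (hD : ∀ (c : Rn n) (l : ℝ), 0 < l →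
      weightMeasure μ (cube c (2 * l)) ≤ D * weightMeasure μ (cube c l))
    (hC : ∀ b f : Rn n → ℝ, MemBMO b → AEStronglyMeasurable f volume →
      MemLp f (ENNReal.ofReal p) (weightMeasure ν) → FracCommDefined α m b f →
        weakLpNorm q (weightMeasure μ) (fracComm α m b f) ≤
          C * bmoNorm b ^ m * eLpNorm f (ENNReal.ofReal p) (weightMeasure ν))
    (c : Rn n) {l : ℝ} (hl : 0 < l) (N : ℕ) {s : ℝ≥0}
    (hs : bumpBound n q r α m C D ≤ s * (volume (cube c l) ^ (α / n + 1 / q - 1 / p) *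
      avgLpNorm q (cube c l) (fun x => ENNReal.ofReal (μ x) ^ (1 / q))))
    (hW0 : volume (cube c l) ^ (α / n + 1 / q - 1 / p) *
      avgLpNorm q (cube c l) (fun x => ENNReal.ofReal (μ x) ^ (1 / q)) ≠ 0)
    (hWt : volume (cube c l) ^ (α / n + 1 / q - 1 / p) *
      avgLpNorm q (cube c l) (fun x => ENNReal.ofReal (μ x) ^ (1 / q)) ≠ ∞) :
    ∫⁻ x in cube c l, logBump r (m * r)
      (min (ENNReal.ofReal (ν x) ^ (-(1 / p))) ((N + 1 : ℕ) : ℝ≥0∞) / s) ≤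
        volume (cube c l) := by
  have hn : n ≠ 0 := by
    rintro rfl
    simp only [Nat.cast_zero] at hαn
    linarith
  have hp0 := hpr.pos
  have hr0 := hpr.symm.pos
  have hr1 := hpr.symm.lt
  set Q := cube c l with hQ
  have hQm : MeasurableSet Q := measurableSet_cube c l
  have hQ0 : volume Q ≠ 0 := volume_cube_pos c hl
  have hQt : volume Q ≠ ∞ := volume_cube_ne_top c l
  have hQreal : volume.real Q = l ^ n := by
    rw [Measure.real, hQ, volume_cube, ENNReal.toReal_pow, ENNReal.toReal_ofReal hl.le]
  have hV0 : 0 < volume.real Q := ENNReal.toReal_pos hQ0 hQt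
  set v := (unitBallVolume n).toReal with hv
  have hv0 : 0 < v := ENNReal.toReal_pos (unitBallVolume_ne_zero n) (unitBallVolume_ne_top n)
  set i : Fin n := ⟨0, Nat.pos_of_ne_zero hn⟩
  set S := cube (shiftedCentre i c l) l with hS
  set w := truncatedWeight ν p N with hw
  have hwm : Measurable w := measurable_truncatedWeight hν p N
  have hwpos : ∀ x, 0 < w x := truncatedWeight_pos ν hp0 N
  have hwN : ∀ x, w x ≤ N + 1 := truncatedWeight_le ν p N
  have hwrm : Measurable fun x => w x ^ r := hwm.pow_const r
  have hwr0 : ∀ x, 0 ≤ w x ^ r := fun x => Real.rpow_nonneg (hwpos x).le r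
  have hwrB : ∀ x, w x ^ r ≤ ((N : ℝ) + 1) ^ r := fun x => by
    have := (hwpos x).le
    gcongr
    exact hwN x
  have hwint : IntegrableOn (fun x => w x ^ r) Q :=
    Measure.integrableOn_of_bounded (M := ((N : ℝ) + 1) ^ r) hQt hwrm.aestronglyMeasurable
      (.of_forall fun x => by rw [Real.norm_of_nonneg (hwr0 x)]; exact hwrB x)
  have hIpos : 0 < ∫ x in Q, w x ^ r := by
    rw [setIntegral_pos_iff_support_of_nonneg_ae (.of_forall hwr0) hwint]
    have : Function.support (fun x => w x ^ r) = univ := by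
      ext x
      simpa using (Real.rpow_pos_of_pos (hwpos x) r).ne'
    rw [this, univ_inter]
    exact pos_iff_ne_zero.2 hQ0
  -- Here b and its supremum depend on the cube and on N, but the bound on its BMO norm does not.
  obtain ⟨b, hbm, hbS, ⟨B, hbB⟩, hbmem, hbmo, hb1, hblog⟩ :=
    exists_bmo_dominating_log hn c hl (S := S)
      (fun x hx y hy => le_dist_of_mem_shifted hx hy) hwrm hwr0 hwrB (div_pos hIpos hV0) rfl
  set F := ∫ y in Q, b y ^ (m * r) * w y ^ r with hF
  have hF0 : 0 ≤ F := setIntegral_nonneg hQm fun y hy =>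
    mul_nonneg (Real.rpow_nonneg (zero_le_one.trans (hb1 y hy)) _) (hwr0 y)
  have hd0 : 0 < (n : ℝ) * (3 * l) := by
    have : (0 : ℝ) < n := by positivity
    positivity
  have htest := testing_inequality hn hpr hα hαn hq hm (μ := μ) hν.aemeasurable
    (C := C * (2 * (oscConst n + 1)) ^ m) (b := b) (w := w) (fun f h1 h2 h3 => by
      refine (hC b f hbmem h1 h2 h3).trans ?_
      gcongr) (c := c) hl (S := S) hd0
    (fun x hx y hy => by
      have h1 := le_dist_of_mem_shifted hx hy
      rw [dist_comm] at h1
      rw [← dist_eq_norm]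
      exact ⟨hl.trans_le h1, dist_le_of_mem_shifted hl.le hx hy⟩)
    hbm hbS hbB hb1 hwm (fun x => (hwpos x).le) hwN (truncatedWeight_rpow_mul_le ν hp0 N)
  have hdbl : weightMeasure μ Q ≤ D ^ 3 * weightMeasure μ S :=
    weightMeasure_cube_le_of_doubling hD i c hl
  -- The power |Q|^{1/q} cancels the normalisation of the L^q average.
  have hWeq : volume Q ^ (α / n + 1 / q - 1 / p) *
      avgLpNorm q Q (fun x => ENNReal.ofReal (μ x) ^ (1 / q)) =
        ENNReal.ofReal ((l ^ n) ^ (α / n - 1 / p)) * weightMeasure μ Q ^ (1 / q) := by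
    rw [avgLpNorm_weight hq, ENNReal.div_rpow_of_nonneg _ _ (by positivity),
      ← ENNReal.ofReal_rpow_of_pos (by positivity), ENNReal.ofReal_pow hl.le, ← volume_cube c l,
      ← hQ, ENNReal.div_eq_inv_mul, ← ENNReal.rpow_neg, ← mul_assoc,
      ← ENNReal.rpow_add _ _ hQ0 hQt]
    congr 2
    ring
  have hkey : ENNReal.ofReal (logConst r v ^ m * (F / volume.real Q) ^ (1 / r)) *
      (volume Q ^ (α / n + 1 / q - 1 / p) *
        avgLpNorm q Q (fun x => ENNReal.ofReal (μ x) ^ (1 / q))) ≤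
      bumpBound n q r α m C D := by
    have hL : 0 ≤ logConst r v := zero_le_one.trans (one_le_logConst r hv0)
    calc ENNReal.ofReal (logConst r v ^ m * (F / volume.real Q) ^ (1 / r)) *
          (volume Q ^ (α / n + 1 / q - 1 / p) *
            avgLpNorm q Q (fun x => ENNReal.ofReal (μ x) ^ (1 / q)))
        = ENNReal.ofReal (logConst r v ^ m * (2 * (n * 3) ^ (n - α)) *
            ((n * (3 * l)) ^ (α - n) / 2 * F ^ (1 / r))) * weightMeasure μ Q ^ (1 / q) := by
          rw [hWeq, ← mul_assoc, ← ENNReal.ofReal_mul (by positivity), mul_assoc (logConst r v ^ m),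
            mul_assoc (logConst r v ^ m), ← scaling_identity hpr hn hl hF0, hQreal,
            mul_comm ((F / l ^ n) ^ (1 / r))]
      _ ≤ ENNReal.ofReal (logConst r v ^ m * (2 * (n * 3) ^ (n - α)) *
            ((n * (3 * l)) ^ (α - n) / 2 * F ^ (1 / r))) *
            (D ^ 3 * weightMeasure μ S) ^ (1 / q) := by gcongr
      _ = ENNReal.ofReal (logConst r v ^ m * (2 * (n * 3) ^ (n - α))) *
            ((D : ℝ≥0∞) ^ 3) ^ (1 / q) *
            (ENNReal.ofReal ((n * (3 * l)) ^ (α - n) / 2 * F ^ (1 / r)) *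
              weightMeasure μ S ^ (1 / q)) := by
          rw [ENNReal.ofReal_mul (by positivity), ENNReal.mul_rpow_of_nonneg _ _ (by positivity)]
          ring
      _ ≤ ENNReal.ofReal (logConst r v ^ m * (2 * (n * 3) ^ (n - α))) *
            ((D : ℝ≥0∞) ^ 3) ^ (1 / q) * (C * (2 * (oscConst n + 1)) ^ m) := by gcongr
      _ ≤ bumpBound n q r α m C D := le_self_add
  have hsreal : logConst r v ^ m * (F / volume.real Q) ^ (1 / r) ≤ s := by
    have h1 := (ENNReal.mul_le_mul_iff_left hW0 hWt).1 (hkey.trans hs)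
    rw [← ENNReal.ofReal_coe_nnreal] at h1
    exact (ENNReal.ofReal_le_ofReal_iff s.2).1 h1
  have hint : IntegrableOn (fun y => b y ^ (m * r) * w y ^ r) Q := by
    refine Measure.integrableOn_of_bounded (M := B ^ (m * r) * ((N : ℝ) + 1) ^ r) hQt
      ((hbm.pow_const _).mul hwrm).aestronglyMeasurable ?_
    filter_upwards [ae_restrict_mem hQm] with y hy
    have h0 : 0 ≤ b y := zero_le_one.trans (hb1 y hy)
    have hw0 := (hwpos y).le
    have hbB' : b y ≤ B := (le_abs_self _).trans (hbB y)
    have hB0 : 0 ≤ B := h0.trans hbB'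
    rw [Real.norm_of_nonneg (by positivity)]
    gcongr
    exact hwN y
  simp_rw [← ofReal_truncatedWeight]
  exact setLIntegral_logBump_le hr1 hv0 m hQm hQ0 hQt hb1 (fun x => (hwpos x).le) hint hwint
    (div_pos hIpos hV0) rfl hblog hsreal

/-- The bump condition on one cube, for a measurable weight `ν`. -/
lemma bump_le_bumpBound {p q r α : ℝ} {m : ℕ} (hpr : p.HolderConjugate r) (hq : 0 < q)
    (hα : 0 < α) (hαn : α < n) (hm : 1 ≤ m) {μ ν : Rn n → ℝ} (hμ : IsWeight μ)
    (hν : Measurable ν) {C D : ℝ≥0}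
    (hD : ∀ (c : Rn n) (l : ℝ), 0 < l →
      weightMeasure μ (cube c (2 * l)) ≤ D * weightMeasure μ (cube c l))
    (hC : ∀ b f : Rn n → ℝ, MemBMO b → AEStronglyMeasurable f volume →
      MemLp f (ENNReal.ofReal p) (weightMeasure ν) → FracCommDefined α m b f →
        weakLpNorm q (weightMeasure μ) (fracComm α m b f) ≤
          C * bmoNorm b ^ m * eLpNorm f (ENNReal.ofReal p) (weightMeasure ν))
    (c : Rn n) {l : ℝ} (hl : 0 < l) :
    volume (cube c l) ^ (α / n + 1 / q - 1 / p) *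
      avgLpNorm q (cube c l) (fun x => ENNReal.ofReal (μ x) ^ (1 / q)) *
      orliczAvg (logBump r (m * r)) (cube c l) (fun x => ENNReal.ofReal (ν x) ^ (-(1 / p))) ≤
        bumpBound n q r α m C D := by
  have hr0 := hpr.symm.pos
  have hQ0 := volume_cube_pos c hl
  have hQt := volume_cube_ne_top c l
  set W := volume (cube c l) ^ (α / n + 1 / q - 1 / p) *
    avgLpNorm q (cube c l) (fun x => ENNReal.ofReal (μ x) ^ (1 / q)) with hW
  -- The Orlicz average may be infinite here; the convention 0 · ∞ = 0 settles this case.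
  rcases eq_or_ne W 0 with hW0 | hW0
  · simp [hW0]
  have hWt : W ≠ ∞ := by
    rw [hW, avgLpNorm_weight hq]
    refine ENNReal.mul_ne_top (ENNReal.rpow_ne_top_of_ne_zero hQ0 hQt)
      (ENNReal.rpow_ne_top_of_nonneg (by positivity) ?_)
    exact ENNReal.div_ne_top (weightMeasure_cube_ne_top hμ c hl.le) hQ0
  set K := bumpBound n q r α m C D with hK
  have hKt : K ≠ ∞ := bumpBound_ne_top n hq r α m C D
  -- The summand 1 in `bumpBound` serves only this: the Luxemburg infimum ranges over s > 0, so K/W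
  -- must be positive.
  have hK0 : K ≠ 0 := by
    rw [hK, bumpBound]
    simp
  obtain ⟨s, hs⟩ : ∃ s : ℝ≥0, (s : ℝ≥0∞) = K / W :=
    ⟨(K / W).toNNReal, ENNReal.coe_toNNReal (ENNReal.div_ne_top hKt hW0)⟩
  have hs0 : 0 < s := by
    rw [← ENNReal.coe_pos, hs]
    exact ENNReal.div_pos hK0 hWt
  have hsW : s * W = K := by rw [hs, ENNReal.div_mul_cancel hW0 hWt]
  have hle : orliczAvg (logBump r (m * r)) (cube c l)
      (fun x => ENNReal.ofReal (ν x) ^ (-(1 / p))) ≤ s := by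
    refine iInf₂_le_of_le s hs0 (iInf_le_of_le ?_ le_rfl)
    rw [setLAverage_eq]
    refine ENNReal.div_le_of_le_mul ?_
    rw [one_mul]
    refine setLIntegral_logBump_le_of_truncations hr0 (by positivity) hs0
      (hν.ennreal_ofReal.pow_const _) fun N => ?_
    exact weight_mul_average_le hpr hq hα hαn hm hν hD hC c hl N hsW.ge hW0 hWt
  calc W * _ ≤ W * s := by gcongr
    _ = K := by rw [mul_comm, hsW]

lemma orliczAvg_congr_ae {A : ℝ≥0∞ → ℝ≥0∞} {Q : Set (Rn n)} {h h' : Rn n → ℝ≥0∞}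
    (hh : h =ᵐ[volume] h') : orliczAvg A Q h = orliczAvg A Q h' := by
  have h1 : ∀ s : ℝ≥0, ⨍⁻ x in Q, A (h x / s) ∂volume =
      ⨍⁻ x in Q, A (h' x / s) ∂volume := fun s =>
    laverage_congr ((ae_restrict_of_ae hh).mono fun x hx => by simp only [hx])
  unfold orliczAvg
  simp_rw [h1]

end Main

end FracComm

theorem theorem1p7 (n : ℕ) (p q α : ℝ) (m : ℕ)
    (hp : 1 < p) (hpq : p ≤ q) (hα : 0 < α) (hαn : α < n) (hm : 1 ≤ m)
    (μ ν : FracComm.Rn n → ℝ)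
    (hμ : FracComm.IsWeight μ) (hν : FracComm.IsWeight ν)
    (hdoubling : FracComm.IsDoubling μ)
    (hbound : ∃ C : ℝ≥0, ∀ b f : FracComm.Rn n → ℝ,
      FracComm.MemBMO b →
      AEStronglyMeasurable f volume →
      MemLp f (ENNReal.ofReal p) (FracComm.weightMeasure ν) →
      FracComm.FracCommDefined α m b f →
        FracComm.weakLpNorm q (FracComm.weightMeasure μ) (FracComm.fracComm α m b f) ≤
          C * FracComm.bmoNorm b ^ m *
            eLpNorm f (ENNReal.ofReal p) (FracComm.weightMeasure ν)) :
    (⨆ (c : FracComm.Rn n) (l : ℝ) (_ : 0 < l),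
      volume (FracComm.cube c l) ^ (α / n + 1 / q - 1 / p) *
        FracComm.avgLpNorm q (FracComm.cube c l) (fun x => ENNReal.ofReal (μ x) ^ (1 / q)) *
        FracComm.orliczAvg (FracComm.logBump (p / (p - 1)) (m * (p / (p - 1))))
          (FracComm.cube c l) (fun x => ENNReal.ofReal (ν x) ^ (-(1 / p)))) < ∞ := by
  obtain ⟨D, hD⟩ := hdoubling
  obtain ⟨C, hC⟩ := hbound
  have hq : 0 < q := by linarith
  have hpr : p.HolderConjugate (p / (p - 1)) := Real.HolderConjugate.conjExponent hp
  -- A weight is only almost everywhere measurable; passing to a measurable representative changes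
  -- neither the measure ν dx nor the Orlicz averages.
  have hνm : AEMeasurable ν volume := hν.locallyIntegrable.aestronglyMeasurable.aemeasurable
  have hνeq : ν =ᵐ[volume] hνm.mk ν := hνm.ae_eq_mk
  have hmeas : FracComm.weightMeasure ν = FracComm.weightMeasure (hνm.mk ν) :=
    withDensity_congr_ae (hνeq.mono fun x hx => by simp only [hx])
  rw [hmeas] at hC
  refine lt_of_le_of_lt (iSup_le fun c => iSup_le fun l => iSup_le fun hl => ?_)
    (FracComm.bumpBound_ne_top n hq (p / (p - 1)) α m C D).lt_top
  rw [FracComm.orliczAvg_congr_ae (h' := fun x => ENNReal.ofReal (hνm.mk ν x) ^ (-(1 / p)))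
    (hνeq.mono fun x hx => by simp only [hx])]
  exact FracComm.bump_le_bumpBound hpr hq hα hαn hm hμ hνm.measurable_mk hD hC c hl
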